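/- Let $\Omega\subset\mathbb R^3$ be a nonempty bounded open set, let $\mathcal S^3$ be the space of symmetric real $3\times3$ matrices with the Frobenius product $A:B$, and let $D:\mathcal S^3\to\mathcal S^3$ be linear, symmetric and positive definite. Put $(\xi,\eta)_D=\int_\Omega D^{1/2}\xi:D^{1/2}\eta\,dx=\int_\Omega D\xi:\eta\,dx$ for $\xi,\eta\in L^2(\Omega,\mathcal S^3)$. Let $w_1,w_2,\dots\in W^{1,2}_0(\Omega,\mathbb R^3)$ be an $L^2$-orthonormal sequence of (weak) eigenfunctions of the operator $-\operatorname{div}D\varepsilon(\cdot)$ with domain $W_0^{1,2}(\Omega,\mathbb R^3)$, where $\varepsilon(w)=\frac12(\nabla w+\nabla^Tw)$. Let $s>\frac32$, let $H^s(\Omega,\mathcal S^3)$ be the (fractional) Sobolev space of restrictions to $\Omega$ of elements of $H^s(\mathbb R^3,\mathcal S^3)$, with the quotient norm, and let $\langle\cdot,\cdot\rangle_s$ be a scalar product on $H^s(\Omega,\mathcal S^3)$ whose norm $\|u\|_{H^s}=\langle u,u\rangle_s^{1/2}$ is equivalent to that norm. For $k\in\mathbb N$ let $$V_k=\{\xi\in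 L^2(\Omega,\mathcal S^3):(\xi,\eta)_D=0\ \text{ for all }\eta\in\operatorname{span}\{\varepsilon(w_1),\dots,\varepsilon(w_k)\}\},\qquad V_k^s=V_k\cap H^s(\Omega,\mathcal S^3).$$ Then there are real numbers $\lambda_1,\lambda_2,\dots$ and $\zeta_1,\zeta_2,\dots\in V_k^s$ with $$\langle\zeta_i,\Phi\rangle_s=\lambda_i(\zeta_i,\Phi)_D\qquad\text{for all }\Phi\in V_k^s\text{ and all }i,$$ such that every eigenvalue of this problem on $V_k^s$ is one of the $\lambda_i$, and * $(\zeta_i,\zeta_j)_D=\delta_{ij}$ for all $i,j$; * $0<\lambda_1\le\lambda_2\le\cdots$ and $\lambda_i\to\infty$; moreover $1\le\lambda_1$ if $\langle\cdot,\cdot\rangle_s$ is normalized so that $(V,V)_D\le\langle V,V\rangle_s$ for all $V\in H^s(\Omega,\mathcal S^3)$; * $\langle\zeta_i/\sqrt{\lambda_i},\,\zeta_j/\sqrt{\lambda_j}\rangle_s=\delta_{ij}$ for all $i,j$; * $\{\zeta_i\}$ is a (Schauder) basis of $V_k^s$ in the norm $\|\cdot\|_{H^s}$; * $\{\zeta_i\}$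 is a (Schauder) basis of $V_k$ in the norm $(\cdot,\cdot)_D^{1/2}$. Finally, for $N\in\mathbb N$ the projections $P^N(V)=\sum_{i=1}^N(V,\zeta_i)_D\,\zeta_i$ satisfy $\|P^N\varphi\|_{H^s}\le\|\varphi\|_{H^s}$ for all $\varphi\in V_k^s$. -/

import Mathlib

open MeasureTheory Filter Topology
open scoped ContDiff

noncomputable section

/-- The space `ℝ³` with its Euclidean norm. -/
abbrev E3 : Type := EuclideanSpace ℝ (Fin 3)

/-- Symmetric real `3 × 3` matrices, with the Frobenius scalar product `A : B = ∑ᵢⱼ Aᵢⱼ Bᵢⱼ`. -/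
def sym3 : Submodule ℝ (EuclideanSpace ℝ (Fin 3 × Fin 3)) where
  carrier := {A | ∀ i j, A (i, j) = A (j, i)}
  add_mem' := by
    intro A B hA hB i j
    simp [hA i j, hB i j]
  zero_mem' := by
    intro i j
    simp
  smul_mem' := by
    intro c A hA i j
    simp [hA i j]

/-- Symmetric real `3 × 3` matrices as a type. -/
abbrev Sym3 : Type := ↥sym3

/-- Symmetric part of a linear map `ℝ³ → ℝ³` (as a Jacobian matrix). -/
def symPartLin : (E3 →L[ℝ] E3) →ₗ[ℝ] Sym3 where
  toFun M := ⟨WithLp.toLp 2 (fun p => (M (EuclideanSpace.single p.2 1) p.1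
      + M (EuclideanSpace.single p.1 1) p.2) / 2), by
    intro i j
    simp [add_comm]⟩
  map_add' M N := by
    ext p
    simp
    ring
  map_smul' c M := by
    ext p
    simp
    ring

/-- The symmetric part, as a continuous linear map. -/
def symPart : (E3 →L[ℝ] E3) →L[ℝ] Sym3 := symPartLin.toContinuousLinearMap

/-- Inclusion of the symmetric real matrices into the complex ones. -/
def complexifyLin : Sym3 →ₗ[ℝ] EuclideanSpace ℂ (Fin 3 × Fin 3) where
  toFun A := WithLp.toLp 2 (fun p => ((A : EuclideanSpace ℝ (Fin 3 × Fin 3)) p : ℂ))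
  map_add' A B := by
    ext p
    simp
  map_smul' c A := by
    ext p
    simp

/-- Inclusion of the symmetric real matrices into the complex ones, as a continuous linear map. -/
def complexify : Sym3 →L[ℝ] EuclideanSpace ℂ (Fin 3 × Fin 3) :=
  complexifyLin.toContinuousLinearMap

/-- `L²(Ω, ℝ³)`. -/
abbrev L2Vec (Ω : Set E3) : Type := Lp E3 2 (volume.restrict Ω)

/-- `L²` of matrix fields (Jacobians) on `Ω`. -/
abbrev L2Grad (Ω : Set E3) : Type := Lp (E3 →L[ℝ] E3) 2 (volume.restrict Ω)

/-- `L²(Ω, 𝒮³)`. -/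
abbrev L2Sym (Ω : Set E3) : Type := Lp Sym3 2 (volume.restrict Ω)

/-- The pairs `(φ, ∇φ)` with `φ ∈ C_c^∞(Ω, ℝ³)`, as elements of `L² × L²`. -/
def testGraph (Ω : Set E3) : Set (L2Vec Ω × L2Grad Ω) :=
  {p | ∃ φ : E3 → E3, ContDiff ℝ ∞ φ ∧ HasCompactSupport φ ∧ tsupport φ ⊆ Ω ∧
    p.1 =ᵐ[volume.restrict Ω] φ ∧ p.2 =ᵐ[volume.restrict Ω] fderiv ℝ φ}

/-- `W₀^{1,2}(Ω, ℝ³)`, the closure of `C_c^∞(Ω, ℝ³)` in `W^{1,2}`; an element is recorded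
together with its weak gradient, i.e. as the pair `(w, ∇w)` in `L² × L²`. -/
def W012 (Ω : Set E3) : Set (L2Vec Ω × L2Grad Ω) := closure (testGraph Ω)

/-- The symmetric gradient `ε(w) = (∇w + (∇w)ᵀ) / 2`. -/
def strain {Ω : Set E3} (w : L2Vec Ω × L2Grad Ω) : L2Sym Ω := symPart.compLp w.2

/-- `(ξ, η)_D = ∫_Ω D ξ : η = ∫_Ω D^{1/2} ξ : D^{1/2} η`. -/
def innerD {Ω : Set E3} (D : Sym3 →ₗ[ℝ] Sym3) (ξ η : L2Sym Ω) : ℝ :=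
  ∫ x in Ω, inner ℝ (D (ξ x)) (η x)

/-- `w` is an `L²`-orthonormal sequence of eigenfunctions of `-div D ε(·)` with domain
`W₀^{1,2}(Ω, ℝ³)` (in the weak sense). -/
structure IsElasticEigensystem (Ω : Set E3) (D : Sym3 →ₗ[ℝ] Sym3)
    (w : ℕ → L2Vec Ω × L2Grad Ω) : Prop where
  mem : ∀ i, w i ∈ W012 Ω
  eigen : ∀ i, ∃ μ : ℝ, ∀ v ∈ W012 Ω,
    innerD D (strain (w i)) (strain v) = μ * inner ℝ (w i).1 v.1
  orthonormal : Orthonormal ℝ (fun i => (w i).1)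

/-- `U ∈ L²(ℝ³, 𝒮³)` restricts to `u` on `Ω`, belongs to `H^s(ℝ³)`, and `f` is its Bessel potential
`𝓕⁻¹ (1 + |·|²)^{s/2} 𝓕 U ∈ L²`; thus `‖f‖` is the norm of `U` in `H^s(ℝ³)`. -/
def IsHsExtension (Ω : Set E3) (s : ℝ) (u : L2Sym Ω) (U : Lp Sym3 2 (volume : Measure E3))
    (f : Lp (EuclideanSpace ℂ (Fin 3 × Fin 3)) 2 (volume : Measure E3)) : Prop :=
  U =ᵐ[volume.restrict Ω] u ∧
    TemperedDistribution.besselPotential E3 (EuclideanSpace ℂ (Fin 3 × Fin 3)) s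
      (Lp.toTemperedDistribution (complexify.compLp U)) = Lp.toTemperedDistribution f

/-- The (fractional) Sobolev space `H^s(Ω, 𝒮³)`: restrictions to `Ω` of elements of
`H^s(ℝ³, 𝒮³)`. -/
def Hs (Ω : Set E3) (s : ℝ) : Submodule ℝ (L2Sym Ω) where
  carrier := {u | ∃ U f, IsHsExtension Ω s u U f}
  add_mem' := by
    rintro u v ⟨U, f, hU, hf⟩ ⟨V, g, hV, hg⟩
    refine ⟨U + V, f + g, ?_, ?_⟩
    · filter_upwards [hU, hV, ae_restrict_of_ae (Lp.coeFn_add U V), Lp.coeFn_add u v]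
        with x h1 h2 h3 h4
      rw [h3, h4, Pi.add_apply, Pi.add_apply, h1, h2]
    · have h : complexify.compLp (U + V) = complexify.compLp U + complexify.compLp V :=
        map_add (ContinuousLinearMap.compLpₗ 2 volume complexify) U V
      rw [h]
      simp only [← Lp.toTemperedDistributionCLM_apply, map_add] at hf hg ⊢
      rw [hf, hg]
  zero_mem' := by
    refine ⟨0, 0, ?_, ?_⟩
    · filter_upwards [ae_restrict_of_ae (Lp.coeFn_zero Sym3 2 (volume : Measure E3)),
        Lp.coeFn_zero Sym3 2 (volume.restrict Ω)] with x h1 h2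
      rw [h1, h2, Pi.zero_apply]
    · have h : complexify.compLp (0 : Lp Sym3 2 (volume : Measure E3)) = 0 :=
        map_zero (ContinuousLinearMap.compLpₗ 2 volume complexify)
      rw [h]
      simp only [← Lp.toTemperedDistributionCLM_apply, map_zero]
  smul_mem' := by
    rintro c u ⟨U, f, hU, hf⟩
    refine ⟨c • U, (c : ℂ) • f, ?_, ?_⟩
    · filter_upwards [hU, ae_restrict_of_ae (Lp.coeFn_smul c U), Lp.coeFn_smul c u]
        with x h1 h2 h3
      rw [h2, h3, Pi.smul_apply, Pi.smul_apply, h1]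
    · have h : complexify.compLp (c • U) = (c : ℂ) • complexify.compLp U := by
        rw [Complex.coe_smul]
        exact map_smul (ContinuousLinearMap.compLpₗ 2 volume complexify) c U
      rw [h]
      simp only [← Lp.toTemperedDistributionCLM_apply, map_smul] at hf ⊢
      rw [hf]

/-- The norm of `H^s(Ω, 𝒮³)`: the infimum of the `H^s(ℝ³)` norms of the extensions. -/
def hsNorm {Ω : Set E3} {s : ℝ} (u : Hs Ω s) : ℝ :=
  sInf {r | ∃ U f, IsHsExtension Ω s (u : L2Sym Ω) U f ∧ r = ‖f‖}

/-- `B` is a scalar product on `H^s(Ω, 𝒮³)` whose norm `u ↦ B(u, u)^{1/2}` is equivalent to the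
norm of `H^s(Ω, 𝒮³)`. -/
structure IsHsScalarProduct (Ω : Set E3) (s : ℝ) (B : LinearMap.BilinForm ℝ (Hs Ω s)) : Prop where
  symm : ∀ u v, B u v = B v u
  equiv : ∃ c C : ℝ, 0 < c ∧ ∀ u, c * hsNorm u ≤ √(B u u) ∧ √(B u u) ≤ C * hsNorm u
  pos : ∀ u, u ≠ 0 → 0 < B u u

/-- `V_k`: the orthogonal complement in `L²(Ω, 𝒮³)`, with respect to `(·,·)_D`, of the span of the
symmetric gradients of the first `k` members of the sequence `w`. -/
def Vk (Ω : Set E3) (D : Sym3 →ₗ[ℝ] Sym3) (w : ℕ → L2Vec Ω × L2Grad Ω) (k : ℕ) :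
    Set (L2Sym Ω) :=
  {ξ | ∀ η ∈ Submodule.span ℝ {e | ∃ i < k, e = strain (w i)}, innerD D ξ η = 0}

/-- `V_k^s = V_k ∩ H^s(Ω, 𝒮³)`. -/
def Vks (Ω : Set E3) (D : Sym3 →ₗ[ℝ] Sym3) (w : ℕ → L2Vec Ω × L2Grad Ω) (k : ℕ) (s : ℝ) :
    Set (Hs Ω s) :=
  {V | (V : L2Sym Ω) ∈ Vk Ω D w k}

/-- `e` is a (Schauder) basis of `W`, for the norm of the scalar product `b`. -/
def IsBasisOf {X : Type*} [AddCommGroup X] [Module ℝ X] (b : X → X → ℝ) (W : Set X)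
    (e : ℕ → X) : Prop :=
  (∀ i, e i ∈ W) ∧ ∀ V ∈ W, ∃! c : ℕ → ℝ,
    Tendsto (fun N : ℕ => √(b (V - ∑ i ∈ Finset.range N, c i • e i)
      (V - ∑ i ∈ Finset.range N, c i • e i))) atTop (𝓝 0)

/-- `P^N V = ∑_{i < N} (V, ζ_i)_D ζ_i`. -/
def projN {Ω : Set E3} {s : ℝ} (D : Sym3 →ₗ[ℝ] Sym3) (ζ : ℕ → Hs Ω s) (N : ℕ) (V : Hs Ω s) :
    Hs Ω s :=
  ∑ i ∈ Finset.range N, innerD D (V : L2Sym Ω) (ζ i : L2Sym Ω) • ζ i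

end

/-!
The embedding of `H^s(Ω, 𝒮³)` into `L²(Ω, 𝒮³)` is compact and has dense range, and so has its
restriction to the subspaces `V_k^s` and `V_k`, which are cut out by finitely many `L²`-continuous
functionals. The eigenvalue problem is that of the pair of scalar products `⟨·,·⟩_s`, `(·,·)_D` on
`V_k^s`, and the theorem is the spectral theorem for such a pair.

* **Spectral part** (`HasCompactSublevels.exists_eigenbasis`). For a form `B` on an inner product
  space whose sublevel sets are sequentially compact, the quotient `B(x, x) / ‖x‖²` attains its
  minimum on the orthogonal complement of finitely many vectors. Successive minimisers are
  eigenvectors, ordered by their eigenvalues. The eigenvalues are unbounded, because an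
  orthonormal sequence has no convergent subsequence. The remainder of an expansion
  satisfies `λ_N ‖r_N‖² ≤ B(V, V)`, and lower semicontinuity of `B` bounds `B(r_N, r_N)` by the tail
  of a convergent series. Neither completeness nor an operator is needed.

* **Compactness** (`IsHsScalarProduct.exists_subseq_tendsto`). `H^s(Ω)` is the image of a closed
  subspace of `L²(ℝ³)` under `f ↦ (𝓕⁻¹ (1 + |·|²)^{-s/2} 𝓕 f)|_Ω`, with the quotient norm. As
  `s > 3/2`, the symbol is square integrable, so the value at a point is a bounded functional of
  `f`, uniformly in the point. Weakly convergent sequences are therefore mapped to sequences that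
  converge pointwise and boundedly on the bounded set `Ω`, hence in `L²(Ω)`.

* **Density and dimension** (`dense_Hs`, `Vk_subset_closure`,
  `not_finiteDimensional_VksSubmodule`). Schwartz functions restrict to elements of `H^s(Ω)` and
  are dense in `L²(Ω)`; density survives on the common kernel of finitely many continuous
  functionals, here the products with `ε(w_1), …, ε(w_k)`. As `L²(Ω)` is infinite-dimensional, so
  is `V_k^s`, a subspace of finite codimension in a dense one.

The orthogonality relations give the uniqueness of the expansions, the completeness of the list
of eigenvalues and the bound for the projections.
-/

/-! ### Expansions along orthonormal sequences -/

section Expansion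

variable {H : Type*} [NormedAddCommGroup H] [InnerProductSpace ℝ H] {e : ℕ → H}

theorem Orthonormal.inner_sub_sum_range_eq_zero (he : Orthonormal ℝ e) (z : H) {N j : ℕ}
    (hj : j < N) :
    inner ℝ (z - ∑ i ∈ Finset.range N, inner ℝ z (e i) • e i) (e j) = 0 := by
  rw [inner_sub_left, sum_inner]
  simp only [inner_smul_left, conj_trivial, orthonormal_iff_ite.1 he]
  simp [hj]

theorem Orthonormal.norm_sub_sum_range_le (he : Orthonormal ℝ e) (z : H) (N : ℕ) :
    ‖z - ∑ i ∈ Finset.range N, inner ℝ z (e i) • e i‖ ≤ ‖z‖ := by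
  set p := ∑ i ∈ Finset.range N, inner ℝ z (e i) • e i with hp
  have h0 : inner ℝ (z - p) p = 0 := by
    conv_lhs => rw [hp, inner_sum]
    refine Finset.sum_eq_zero fun i hi => ?_
    rw [inner_smul_right, he.inner_sub_sum_range_eq_zero z (Finset.mem_range.1 hi), mul_zero]
  have h1 := norm_add_sq_real (z - p) p
  rw [sub_add_cancel, h0] at h1
  nlinarith [norm_nonneg z, norm_nonneg (z - p), norm_nonneg p]

/-- The Fourier partial sums of `V` converge to `V` as soon as this holds for vectors
arbitrarily close to `V`, because `1 - P_N` is a contraction. -/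
theorem Orthonormal.tendsto_sub_sum_range_of_approx (he : Orthonormal ℝ e) (V : H)
    (h : ∀ ε > 0, ∃ U : H, ‖V - U‖ < ε ∧
      Tendsto (fun N => ‖U - ∑ i ∈ Finset.range N, inner ℝ U (e i) • e i‖) atTop (𝓝 0)) :
    Tendsto (fun N => ‖V - ∑ i ∈ Finset.range N, inner ℝ V (e i) • e i‖) atTop (𝓝 0) := by
  rw [Metric.tendsto_atTop]
  intro ε hε
  obtain ⟨U, hU, hlim⟩ := h (ε / 2) (by positivity)
  obtain ⟨N₀, hN₀⟩ := Metric.tendsto_atTop.1 hlim (ε / 2) (by positivity)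
  refine ⟨N₀, fun N hN => ?_⟩
  have h1 := hN₀ N hN
  rw [Real.dist_eq, sub_zero, abs_norm] at h1 ⊢
  have h2 : V - ∑ i ∈ Finset.range N, inner ℝ V (e i) • e i
      = ((V - U) - ∑ i ∈ Finset.range N, inner ℝ (V - U) (e i) • e i)
        + (U - ∑ i ∈ Finset.range N, inner ℝ U (e i) • e i) := by
    simp only [inner_sub_left, sub_smul, Finset.sum_sub_distrib]
    abel
  rw [h2]
  linarith [norm_add_le ((V - U) - ∑ i ∈ Finset.range N, inner ℝ (V - U) (e i) • e i)
    (U - ∑ i ∈ Finset.range N, inner ℝ U (e i) • e i), he.norm_sub_sum_range_le (V - U) N]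

end Expansion

/-! ### Eigenvectors of a form with compact sublevel sets -/

section Spectral

variable {X : Type*} [NormedAddCommGroup X] [InnerProductSpace ℝ X]
  (B : LinearMap.BilinForm ℝ X)

/-- The sublevel sets of the quadratic form `B` are sequentially compact. For a
scalar product `B` this says that the space with norm `B(u, u)^{1/2}` is complete and embeds
compactly. -/
def HasCompactSublevels : Prop :=
  ∀ (R : ℝ) (u : ℕ → X), (∀ n, B (u n) (u n) ≤ R) →
    ∃ (x : X) (φ : ℕ → ℕ), StrictMono φ ∧ B x x ≤ R ∧ Tendsto (fun n => u (φ n)) atTop (𝓝 x)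

variable {B}

theorem HasCompactSublevels.le_of_tendsto (hc : HasCompactSublevels B) {u : ℕ → X} {x : X} {R : ℝ}
    (hu : ∀ᶠ n in atTop, B (u n) (u n) ≤ R) (hx : Tendsto u atTop (𝓝 x)) : B x x ≤ R := by
  obtain ⟨N, hN⟩ := eventually_atTop.1 hu
  obtain ⟨y, φ, hφ, hy, hlim⟩ := hc R (fun n => u (n + N)) fun n => hN _ (by omega)
  have h1 : Tendsto (fun n => u (φ n + N)) atTop (𝓝 x) :=
    hx.comp (tendsto_atTop_mono (fun n => Nat.le_add_right _ _) hφ.tendsto_atTop)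
  rwa [tendsto_nhds_unique h1 hlim]

/-- The quotient `B(y, y) / ‖y‖²` attains its minimum on the orthogonal complement of a
finite set. -/
theorem HasCompactSublevels.exists_minimizer (hc : HasCompactSublevels B)
    (hpos : ∀ u, 0 ≤ B u u) (s : Finset X)
    (hs : ∃ y : X, y ≠ 0 ∧ ∀ z ∈ s, inner ℝ y z = 0) :
    ∃ x : X, ‖x‖ = 1 ∧ (∀ z ∈ s, inner ℝ x z = 0) ∧
      ∀ y, (∀ z ∈ s, inner ℝ y z = 0) → B x x * ‖y‖ ^ 2 ≤ B y y := by
  set A : Set ℝ := {r | ∃ y : X, ‖y‖ = 1 ∧ (∀ z ∈ s, inner ℝ y z = 0) ∧ B y y = r} with hA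
  have hmem : ∀ y : X, y ≠ 0 → (∀ z ∈ s, inner ℝ y z = 0) → (‖y‖ ^ 2)⁻¹ * B y y ∈ A := by
    intro y hy hyz
    refine ⟨‖y‖⁻¹ • y, ?_, fun z hz => ?_, ?_⟩
    · rw [norm_smul, norm_inv, norm_norm, inv_mul_cancel₀ (norm_ne_zero_iff.2 hy)]
    · rw [inner_smul_left, hyz z hz, mul_zero]
    · simp only [map_smul, LinearMap.smul_apply, smul_eq_mul]
      ring
  have hbdd : BddBelow A := ⟨0, by rintro r ⟨y, -, -, rfl⟩; exact hpos y⟩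
  have hne : A.Nonempty := by
    obtain ⟨y, hy, hyz⟩ := hs
    exact ⟨_, hmem y hy hyz⟩
  set m := sInf A
  have hseq : ∀ n : ℕ, ∃ y : X, ‖y‖ = 1 ∧ (∀ z ∈ s, inner ℝ y z = 0) ∧
      B y y < m + 1 / ((n : ℝ) + 1) := by
    intro n
    obtain ⟨r, ⟨y, h1, h2, rfl⟩, hr⟩ := Real.lt_sInf_add_pos hne
      (Nat.one_div_pos_of_nat (α := ℝ) (n := n))
    exact ⟨y, h1, h2, hr⟩
  choose y hy1 hyz hyB using hseq
  obtain ⟨x, φ, hφ, -, hlim⟩ := hc (m + 1) y fun n => (hyB n).le.trans (by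
    have : 1 / ((n : ℝ) + 1) ≤ 1 := by
      rw [div_le_one (by positivity)]
      linarith [Nat.cast_nonneg (α := ℝ) n]
    linarith)
  -- `B x x ≤ m + 1` does not suffice: lower semicontinuity gives `B x x ≤ m + ε` for every `ε`.
  have hxm : B x x ≤ m := by
    refine le_of_forall_pos_le_add fun ε hε => hc.le_of_tendsto ?_ hlim
    have h1 : Tendsto (fun n : ℕ => 1 / (((φ n : ℕ) : ℝ) + 1)) atTop (𝓝 0) :=
      tendsto_one_div_add_atTop_nhds_zero_nat.comp hφ.tendsto_atTop
    filter_upwards [h1.eventually (gt_mem_nhds hε)] with n hn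
    linarith [hyB (φ n)]
  refine ⟨x, ?_, fun z hz => ?_, fun v hv => ?_⟩
  · refine tendsto_nhds_unique hlim.norm ?_
    simp only [hy1]
    exact tendsto_const_nhds
  · refine tendsto_nhds_unique (hlim.inner tendsto_const_nhds) ?_
    simp only [hyz _ z hz]
    exact tendsto_const_nhds
  · rcases eq_or_ne v 0 with rfl | hv0
    · simp
    · have h1 := hxm.trans (csInf_le hbdd (hmem v hv0 hv))
      have h2 : 0 < ‖v‖ ^ 2 := by positivity
      rw [← div_eq_inv_mul] at h1
      exact (le_div_iff₀ h2).1 h1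

/-- Recursive choice of a sequence whose `n`-th term depends on the set of all earlier ones. -/
theorem exists_seq_of_forall_finset {α : Type*} (Q : Finset α → α → Prop)
    (h : ∀ s, ∃ x, Q s x) : ∃ f : ℕ → α, ∀ n, ∃ s : Finset α, (∀ z, z ∈ s ↔ ∃ m < n, f m = z) ∧
      Q s (f n) := by
  classical
  choose g hg using h
  let T : ℕ → Finset α := fun n => Nat.rec ∅ (fun _ s => insert (g s) s) n
  have hT : ∀ n z, z ∈ T n ↔ ∃ m < n, g (T m) = z := by
    intro n
    induction n with
    | zero => simp [T]
    | succ n ih =>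
      intro z
      have h1 : T (n + 1) = insert (g (T n)) (T n) := rfl
      rw [h1, Finset.mem_insert, ih, Nat.exists_lt_succ_right, or_comm, eq_comm]
  exact ⟨fun n => g (T n), fun n => ⟨T n, hT n, hg _⟩⟩

theorem exists_ne_zero_forall_inner_eq_zero (hinf : ¬ FiniteDimensional ℝ X) (s : Finset X) :
    ∃ y : X, y ≠ 0 ∧ ∀ z ∈ s, inner ℝ y z = 0 := by
  by_contra! hcon
  let L : X →ₗ[ℝ] (s → ℝ) := LinearMap.pi fun z => ((innerₗ X) (z : X))
  refine hinf (FiniteDimensional.of_injective L ?_)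
  rw [← LinearMap.ker_eq_bot, LinearMap.ker_eq_bot']
  intro y hy
  by_contra hy0
  obtain ⟨z, hz, hne⟩ := hcon y hy0
  refine hne ?_
  rw [real_inner_comm]
  exact congrFun hy ⟨z, hz⟩

theorem eq_zero_of_forall_quadratic_nonneg {p q : ℝ} (h : ∀ t : ℝ, 0 ≤ 2 * t * p + t ^ 2 * q) :
    p = 0 := by
  have h1 := h (-p / (1 + |q|))
  have h2 : 0 < 1 + |q| := by positivity
  have h3 : 2 * (-p / (1 + |q|)) * p + (-p / (1 + |q|)) ^ 2 * q
      = p ^ 2 * (q - 2 * (1 + |q|)) / (1 + |q|) ^ 2 := by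
    field_simp
    ring
  rw [h3] at h1
  by_contra hp
  have h4 : p ^ 2 * (q - 2 * (1 + |q|)) < 0 :=
    mul_neg_of_pos_of_neg (by positivity) (by linarith [le_abs_self q, abs_nonneg q])
  exact absurd h1 (not_le.2 (div_neg_of_neg_of_pos h4 (by positivity)))

theorem bilin_sum_smul_self {lam : ℕ → ℝ} {ζ : ℕ → X} (hζ : Orthonormal ℝ ζ)
    (heig : ∀ i Φ, B (ζ i) Φ = lam i * inner ℝ (ζ i) Φ) (S : Finset ℕ) (c : ℕ → ℝ) :
    B (∑ i ∈ S, c i • ζ i) (∑ i ∈ S, c i • ζ i) = ∑ i ∈ S, lam i * c i ^ 2 := by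
  rw [LinearMap.BilinForm.sum_left]
  refine Finset.sum_congr rfl fun i hi => ?_
  rw [map_smul, LinearMap.smul_apply, heig, inner_sum]
  simp only [inner_smul_right, orthonormal_iff_ite.1 hζ]
  simp [hi]
  ring

/-- Minimising `B(x, x)` on the unit sphere, successively orthogonally to the minimisers already
found, yields all eigenvectors in the order of their eigenvalues. -/
theorem HasCompactSublevels.exists_eigenbasis (hc : HasCompactSublevels B)
    (hsymm : ∀ u v, B u v = B v u) (hpos : ∀ u, u ≠ 0 → 0 < B u u)
    (hinf : ¬ FiniteDimensional ℝ X) :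
    ∃ (lam : ℕ → ℝ) (ζ : ℕ → X), Orthonormal ℝ ζ ∧
      (∀ i Φ, B (ζ i) Φ = lam i * inner ℝ (ζ i) Φ) ∧ Monotone lam ∧ Tendsto lam atTop atTop ∧
      (∀ V, Tendsto (fun N => ‖V - ∑ i ∈ Finset.range N, inner ℝ V (ζ i) • ζ i‖) atTop (𝓝 0)) ∧
      (∀ V, Tendsto (fun N => B (V - ∑ i ∈ Finset.range N, inner ℝ V (ζ i) • ζ i)
        (V - ∑ i ∈ Finset.range N, inner ℝ V (ζ i) • ζ i)) atTop (𝓝 0)) := by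
  have hnonneg : ∀ u, 0 ≤ B u u := by
    intro u
    rcases eq_or_ne u 0 with rfl | hu
    · simp
    · exact (hpos u hu).le
  obtain ⟨ζ, hζ⟩ := exists_seq_of_forall_finset _ fun s : Finset X =>
    hc.exists_minimizer hnonneg s (exists_ne_zero_forall_inner_eq_zero hinf s)
  have hnorm : ∀ n, ‖ζ n‖ = 1 := fun n => by
    obtain ⟨s, -, h, -⟩ := hζ n
    exact h
  have horth : ∀ m n, m < n → inner ℝ (ζ n) (ζ m) = 0 := fun m n hmn => by
    obtain ⟨s, hs, -, h, -⟩ := hζ n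
    exact h (ζ m) ((hs _).2 ⟨m, hmn, rfl⟩)
  have hmin : ∀ n y, (∀ m < n, inner ℝ y (ζ m) = 0) → B (ζ n) (ζ n) * ‖y‖ ^ 2 ≤ B y y := by
    intro n y hy
    obtain ⟨s, hs, -, -, h⟩ := hζ n
    refine h y fun z hz => ?_
    obtain ⟨m, hm, rfl⟩ := (hs z).1 hz
    exact hy m hm
  have hon : Orthonormal ℝ ζ := by
    refine ⟨hnorm, fun i j hij => ?_⟩
    rcases lt_or_gt_of_ne hij with h | h
    · rw [real_inner_comm]
      exact horth i j h
    · exact horth j i h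
  set lam : ℕ → ℝ := fun n => B (ζ n) (ζ n) with hlam
  -- First variation, for directions orthogonal to the earlier minimisers.
  have heig0 : ∀ n Φ, (∀ m < n, inner ℝ Φ (ζ m) = 0) →
      B (ζ n) Φ = lam n * inner ℝ (ζ n) Φ := by
    intro n Φ hΦ
    have key : B (ζ n) Φ - lam n * inner ℝ (ζ n) Φ = 0 := by
      refine eq_zero_of_forall_quadratic_nonneg (q := B Φ Φ - lam n * ‖Φ‖ ^ 2) fun t => ?_
      have h1 := hmin n (ζ n + t • Φ) fun m hm => by
        rw [inner_add_left, inner_smul_left, horth m n hm, hΦ m hm]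
        simp
      rw [norm_add_sq_real, hnorm n, inner_smul_right, norm_smul, mul_pow, Real.norm_eq_abs,
        sq_abs] at h1
      simp only [map_add, map_smul, LinearMap.add_apply, LinearMap.smul_apply, smul_eq_mul,
        hsymm Φ (ζ n)] at h1
      simp only [hlam]
      linarith
    linarith
  have heig : ∀ i Φ, B (ζ i) Φ = lam i * inner ℝ (ζ i) Φ := by
    intro n
    induction n using Nat.strong_induction_on with
    | _ n ih =>
      intro Φ
      have h1 := heig0 n (Φ - ∑ i ∈ Finset.range n, inner ℝ Φ (ζ i) • ζ i)
        fun m hm => hon.inner_sub_sum_range_eq_zero Φ hm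
      have h2 : B (ζ n) (∑ i ∈ Finset.range n, inner ℝ Φ (ζ i) • ζ i) = 0 := by
        rw [map_sum]
        refine Finset.sum_eq_zero fun i hi => ?_
        rw [map_smul, hsymm, ih i (Finset.mem_range.1 hi), real_inner_comm (ζ n),
          horth i n (Finset.mem_range.1 hi)]
        simp
      have h3 : inner ℝ (ζ n) (∑ i ∈ Finset.range n, inner ℝ Φ (ζ i) • ζ i) = 0 := by
        rw [inner_sum]
        refine Finset.sum_eq_zero fun i hi => ?_
        rw [inner_smul_right, horth i n (Finset.mem_range.1 hi), mul_zero]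
      rwa [map_sub, h2, inner_sub_right, h3, sub_zero, sub_zero] at h1
  have hmono : Monotone lam := by
    refine monotone_nat_of_le_succ fun n => ?_
    have h := hmin n (ζ (n + 1)) fun m hm => horth m (n + 1) (by omega)
    rwa [hnorm, one_pow, mul_one] at h
  -- If `lam` were bounded, a subsequence of the orthonormal sequence `ζ` would converge.
  have hlim : Tendsto lam atTop atTop := by
    rcases tendsto_atTop_of_monotone hmono with h | ⟨l, hl⟩
    · exact h
    · exfalso
      obtain ⟨x, φ, hφ, -, hx⟩ := hc l ζ fun n => hmono.ge_of_tendsto hl n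
      have h1 : Tendsto (fun n => ‖ζ (φ n) - ζ (φ (n + 1))‖) atTop (𝓝 ‖x - x‖) :=
        (hx.sub (hx.comp (tendsto_add_atTop_nat 1))).norm
      have h2 : ∀ n, ‖ζ (φ n) - ζ (φ (n + 1))‖ = √2 := by
        intro n
        rw [← Real.sqrt_sq (norm_nonneg (ζ (φ n) - ζ (φ (n + 1)))), norm_sub_sq_real, hnorm, hnorm,
          hon.2 (hφ (Nat.lt_succ_self n)).ne]
        norm_num
      simp only [h2, sub_self, norm_zero] at h1
      have h3 : (0 : ℝ) = √2 := tendsto_nhds_unique h1 tendsto_const_nhds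
      exact (by positivity : √(2 : ℝ) ≠ 0) h3.symm
  -- The expansion is orthogonal for `B` as well.
  have hpyth : ∀ V N, B V V = B (V - ∑ i ∈ Finset.range N, inner ℝ V (ζ i) • ζ i)
      (V - ∑ i ∈ Finset.range N, inner ℝ V (ζ i) • ζ i)
      + ∑ i ∈ Finset.range N, lam i * (inner ℝ V (ζ i)) ^ 2 := by
    intro V N
    rw [← bilin_sum_smul_self hon heig]
    set p := ∑ i ∈ Finset.range N, inner ℝ V (ζ i) • ζ i with hp
    have h0 : B (V - p) p = 0 := by
      conv_lhs => rw [hp, map_sum]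
      refine Finset.sum_eq_zero fun i hi => ?_
      rw [map_smul, hsymm, heig, real_inner_comm (V - _),
        hon.inner_sub_sum_range_eq_zero V (Finset.mem_range.1 hi)]
      simp
    have h1 : B V V = B ((V - p) + p) ((V - p) + p) := by rw [sub_add_cancel]
    rw [h1, LinearMap.BilinForm.add_left, LinearMap.BilinForm.add_right,
      LinearMap.BilinForm.add_right, hsymm p, h0]
    ring
  have hlampos : ∀ n, 0 < lam n := fun n => hpos _ (by
    rw [← norm_ne_zero_iff, hnorm]
    exact one_ne_zero)
  have hbasis : ∀ V, Tendsto (fun N => ‖V - ∑ i ∈ Finset.range N, inner ℝ V (ζ i) • ζ i‖) atTop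
      (𝓝 0) := by
    intro V
    have h1 : Tendsto (fun N => ‖V - ∑ i ∈ Finset.range N, inner ℝ V (ζ i) • ζ i‖ ^ 2) atTop
        (𝓝 0) := by
      refine squeeze_zero (g := fun N => B V V / lam N) (fun N => by positivity) (fun N => ?_)
        (hlim.const_div_atTop _)
      rw [le_div_iff₀ (hlampos N), mul_comm]
      refine (hmin N _ fun m hm => hon.inner_sub_sum_range_eq_zero V hm).trans ?_
      rw [hpyth V N]
      exact le_add_of_nonneg_right
        (Finset.sum_nonneg fun i _ => mul_nonneg (hlampos i).le (sq_nonneg _))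
    have h2 := h1.sqrt
    simpa [Real.sqrt_sq] using h2
  refine ⟨lam, ζ, hon, heig, hmono, hlim, hbasis, fun V => ?_⟩
  -- Lower semicontinuity of `B` bounds the remainder by the tail of a convergent series.
  set a : ℕ → ℝ := fun N => ∑ i ∈ Finset.range N, lam i * (inner ℝ V (ζ i)) ^ 2 with ha
  have hterm : ∀ i, 0 ≤ lam i * (inner ℝ V (ζ i)) ^ 2 :=
    fun i => mul_nonneg (hlampos i).le (sq_nonneg _)
  have hamono : Monotone a := by
    refine monotone_nat_of_le_succ fun n => ?_
    simp only [ha, Finset.sum_range_succ]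
    exact le_add_of_nonneg_right (hterm n)
  have habdd : BddAbove (Set.range a) := ⟨B V V, by
    rintro _ ⟨N, rfl⟩
    rw [hpyth V N]
    exact le_add_of_nonneg_left (hnonneg _)⟩
  have halim := tendsto_atTop_ciSup hamono habdd
  have hbound : ∀ N, B (V - ∑ i ∈ Finset.range N, inner ℝ V (ζ i) • ζ i)
      (V - ∑ i ∈ Finset.range N, inner ℝ V (ζ i) • ζ i) ≤ (⨆ n, a n) - a N := by
    intro N
    refine hc.le_of_tendsto (u := fun M => ∑ i ∈ Finset.range M, inner ℝ V (ζ i) • ζ i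
      - ∑ i ∈ Finset.range N, inner ℝ V (ζ i) • ζ i) ?_ ?_
    · filter_upwards [eventually_ge_atTop N] with M hM
      rw [← Finset.sum_Ico_eq_sub _ hM, bilin_sum_smul_self hon heig, Finset.sum_Ico_eq_sub _ hM]
      exact sub_le_sub_right (le_ciSup habdd M) _
    · refine Tendsto.sub ?_ tendsto_const_nhds
      rw [tendsto_iff_norm_sub_tendsto_zero]
      simpa only [norm_sub_rev] using hbasis V
  refine squeeze_zero (fun N => hnonneg _) hbound ?_
  simpa using halim.const_sub (⨆ n, a n)

end Spectral

/-! ### Bessel potentials of negative order on `L²` -/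

section Bessel

open FourierTransform
open scoped ENNReal

variable (E F : Type*) [NormedAddCommGroup E]

/-- The symbol `(1 + |ξ|²)^{-s/2}`, written with the exponent `(-s) / 2` that
`TemperedDistribution.besselPotential E F (-s)` unfolds to. -/
noncomputable def besselSymbol (s : ℝ) : E → ℂ := fun ξ => (((1 + ‖ξ‖ ^ 2) ^ ((-s) / 2) : ℝ) : ℂ)

theorem norm_besselSymbol (s : ℝ) (ξ : E) :
    ‖besselSymbol E s ξ‖ = (1 + ‖ξ‖ ^ 2) ^ ((-s) / 2) := by
  rw [besselSymbol, Complex.norm_real, Real.norm_of_nonneg (by positivity)]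

variable [InnerProductSpace ℝ E]

theorem besselSymbol_hasTemperateGrowth (s : ℝ) : (besselSymbol E s).HasTemperateGrowth := by
  unfold besselSymbol
  fun_prop

variable [FiniteDimensional ℝ E] [MeasurableSpace E] [BorelSpace E]

theorem memLp_top_besselSymbol {s : ℝ} (hs : 0 ≤ s) :
    MemLp (besselSymbol E s) ⊤ (volume : Measure E) := by
  refine memLp_top_of_bound
    (besselSymbol_hasTemperateGrowth E s).1.continuous.aestronglyMeasurable 1
    (ae_of_all _ fun ξ => ?_)
  rw [norm_besselSymbol]
  exact Real.rpow_le_one_of_one_le_of_nonpos (by linarith [sq_nonneg ‖ξ‖]) (by linarith)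

theorem memLp_two_besselSymbol {s : ℝ} (hs : Module.finrank ℝ E < 2 * s) :
    MemLp (besselSymbol E s) 2 (volume : Measure E) := by
  rw [memLp_two_iff_integrable_sq_norm
    (besselSymbol_hasTemperateGrowth E s).1.continuous.aestronglyMeasurable]
  refine (integrable_rpow_neg_one_add_norm_sq (μ := volume) hs).congr (ae_of_all _ fun ξ => ?_)
  simp only [norm_besselSymbol]
  rw [← Real.rpow_mul_natCast (by positivity)]
  congr 1
  push_cast
  ring

variable [NormedAddCommGroup F] [InnerProductSpace ℂ F]

variable {E F} in
theorem integrable_besselSymbol_smul {s : ℝ} (hs : Module.finrank ℝ E < 2 * s)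
    (g : Lp F 2 (volume : Measure E)) : Integrable (fun ξ => besselSymbol E s ξ • g ξ) :=
  memLp_one_iff_integrable.1 ((Lp.memLp g).smul (memLp_two_besselSymbol E hs))

variable [CompleteSpace F]

/-- The Bessel potential `𝓕⁻¹ (1 + |·|²)^{-s/2} 𝓕` as a bounded operator on `L²`. -/
noncomputable def besselL2 {s : ℝ} (hs : 0 ≤ s) :
    Lp F 2 (volume : Measure E) →L[ℂ] Lp F 2 (volume : Measure E) :=
  (fourierInvCLM ℂ (Lp F 2 (volume : Measure E))) ∘L
    ((ContinuousLinearMap.lsmul ℂ ℂ).holderL volume ⊤ 2 2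
      (memLp_top_besselSymbol E hs).toLp) ∘L
    (fourierCLM ℂ (Lp F 2 (volume : Measure E)))

variable {E F}

theorem fourier_besselL2 {s : ℝ} (hs : 0 ≤ s) (f : Lp F 2 (volume : Measure E)) :
    𝓕 (besselL2 E F hs f) = ((memLp_top_besselSymbol E hs).toLp • 𝓕 f : Lp F 2 volume) := by
  simp only [besselL2, ContinuousLinearMap.comp_apply, fourierInvCLM_apply, fourierCLM_apply,
    fourier_fourierInv_eq]
  rfl

theorem toTemperedDistribution_besselL2 {s : ℝ} (hs : 0 ≤ s) (f : Lp F 2 (volume : Measure E)) :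
    Lp.toTemperedDistribution (besselL2 E F hs f)
      = TemperedDistribution.besselPotential E F (-s) (Lp.toTemperedDistribution f) := by
  have h : 𝓕 (Lp.toTemperedDistribution (besselL2 E F hs f))
      = 𝓕 (TemperedDistribution.besselPotential E F (-s) (Lp.toTemperedDistribution f)) := by
    rw [TemperedDistribution.fourier_besselPotential_eq_smulLeftCLM_fourier_apply,
      Lp.fourier_toTemperedDistribution_eq, Lp.fourier_toTemperedDistribution_eq,
      fourier_besselL2]
    exact Lp.toTemperedDistribution_smul_eq (besselSymbol_hasTemperateGrowth E s)
      (memLp_top_besselSymbol E hs) (𝓕 f)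
  have h' := congrArg (fun T : TemperedDistribution E F => (𝓕⁻ T : TemperedDistribution E F)) h
  simpa only [fourierInv_fourier_eq] using h'

/-- An `Lp` function is determined by the tempered distribution that it represents. -/
theorem toTemperedDistribution_injective {p : ℝ≥0∞} [Fact (1 ≤ p)] :
    Function.Injective (Lp.toTemperedDistribution : Lp F p (volume : Measure E) → _) := by
  have h := Lp.ker_toTemperedDistributionCLM_eq_bot (F := F) (μ := (volume : Measure E)) (p := p)
  exact LinearMap.ker_eq_bot.1 h

theorem besselL2_eq_iff {s : ℝ} (hs : 0 ≤ s) (f g : Lp F 2 (volume : Measure E)) :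
    besselL2 E F hs f = g ↔
      TemperedDistribution.besselPotential E F s (Lp.toTemperedDistribution g)
        = Lp.toTemperedDistribution f := by
  rw [← TemperedDistribution.besselPotential_neg_apply_eq_iff, ← toTemperedDistribution_besselL2 hs,
    toTemperedDistribution_injective.eq_iff]

variable (E F)

theorem memLp_fourierChar_smul_besselSymbol {s : ℝ} (hs : Module.finrank ℝ E < 2 * s) (x : E) :
    MemLp (fun ξ => (Real.fourierChar (inner ℝ ξ x) : ℂ) * besselSymbol E s ξ) 2
      (volume : Measure E) := by
  refine (memLp_two_besselSymbol E hs).of_le (Continuous.aestronglyMeasurable ?_)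
    (ae_of_all _ fun ξ => by simp [Circle.norm_coe])
  have h1 := (besselSymbol_hasTemperateGrowth E s).1.continuous
  have h2 := Real.continuous_fourierChar
  fun_prop

/-- The value at `x` of the Bessel potential of order `-s < -d/2`: for such `s` the symbol is
square integrable, and `f ↦ ∫ e^{2πi⟨ξ, x⟩} (1 + |ξ|²)^{-s/2} 𝓕 f(ξ) dξ` is bounded on `L²`. -/
noncomputable def besselEval {s : ℝ} (hs : Module.finrank ℝ E < 2 * s) (x : E) :
    Lp F 2 (volume : Measure E) →L[ℂ] F :=
  ((ContinuousLinearMap.lsmul ℂ ℂ).lpPairing volume 2 2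
      (memLp_fourierChar_smul_besselSymbol E hs x).toLp) ∘L
    (fourierCLM ℂ (Lp F 2 (volume : Measure E)))

variable {E F}

theorem besselEval_apply {s : ℝ} (hs : Module.finrank ℝ E < 2 * s) (x : E)
    (f : Lp F 2 (volume : Measure E)) :
    besselEval E F hs x f = 𝓕⁻ (fun ξ => besselSymbol E s ξ • (𝓕 f : Lp F 2 volume) ξ) x := by
  rw [besselEval, ContinuousLinearMap.comp_apply, ContinuousLinearMap.lpPairing_eq_integral,
    Real.fourierInv_eq]
  refine integral_congr_ae ?_
  filter_upwards [(memLp_fourierChar_smul_besselSymbol E hs x).coeFn_toLp] with ξ hξ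
  rw [hξ, ContinuousLinearMap.lsmul_apply, fourierCLM_apply, mul_smul]
  rfl

theorem norm_integral_smul_le_norm_mul_norm (k : Lp ℂ 2 (volume : Measure E))
    (g : Lp F 2 (volume : Measure E)) : ‖∫ ξ, k ξ • g ξ‖ ≤ ‖k‖ * ‖g‖ := by
  have h : ∫ ξ, k ξ • g ξ = ∫ ξ, (k • g : Lp F 1 volume) ξ :=
    integral_congr_ae (Lp.coeFn_lpSMul k g).symm
  rw [h, ← L1.integral_eq_integral]
  exact (L1.norm_integral_le _).trans (Lp.norm_smul_le k g)

/-- The operators `besselEval` are bounded uniformly in `x`. -/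
theorem exists_norm_besselEval_le {s : ℝ} (hs : Module.finrank ℝ E < 2 * s) :
    ∃ C, 0 ≤ C ∧ ∀ (x : E) (f : Lp F 2 (volume : Measure E)), ‖besselEval E F hs x f‖ ≤ C * ‖f‖ := by
  refine ⟨‖(memLp_two_besselSymbol E hs).toLp‖, norm_nonneg _, fun x f => ?_⟩
  have h1 : ‖(memLp_fourierChar_smul_besselSymbol E hs x).toLp‖
      = ‖(memLp_two_besselSymbol E hs).toLp‖ := by
    rw [Lp.norm_toLp, Lp.norm_toLp]
    congr 1
    exact eLpNorm_congr_norm_ae (ae_of_all _ fun ξ => by simp [Circle.norm_coe])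
  rw [← h1, ← Lp.norm_fourier_eq f, besselEval, ContinuousLinearMap.comp_apply,
    ContinuousLinearMap.lpPairing_eq_integral]
  exact norm_integral_smul_le_norm_mul_norm _ _

/-- Self-adjointness of the inverse Fourier transform, with only one factor a Schwartz function. -/
theorem integral_fourierInv_smul_eq_of_integrable (φ : SchwartzMap E ℂ) {g : E → F}
    (hg : Integrable g) : ∫ ξ, (𝓕⁻ φ) ξ • g ξ = ∫ x, φ x • 𝓕⁻ g x := by
  have h := VectorFourier.integral_fourierIntegral_smul_eq_flip (μ := (volume : Measure E))
    (ν := volume) (L := -(innerₗ E))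
    Real.continuous_fourierChar continuous_inner.neg φ.integrable hg
  have hflip : (-(innerₗ E)).flip = -(innerₗ E) := by
    ext x y
    simp [real_inner_comm]
  rw [hflip] at h
  rw [SchwartzMap.fourierInv_coe]
  exact h

/-- On `L²` the Bessel potential of order `-s < -d/2` is given pointwise by `besselEval`. -/
theorem besselL2_ae_eq {s : ℝ} (hs0 : 0 ≤ s) (hs : Module.finrank ℝ E < 2 * s)
    (f : Lp F 2 (volume : Measure E)) :
    besselL2 E F hs0 f =ᵐ[volume] fun x => besselEval E F hs x f := by
  have hint := integrable_besselSymbol_smul hs (𝓕 f : Lp F 2 (volume : Measure E))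
  have hcont : Continuous (𝓕⁻ fun ξ => besselSymbol E s ξ • (𝓕 f : Lp F 2 volume) ξ) := by
    have h := VectorFourier.fourierIntegral_continuous (μ := (volume : Measure E))
      (L := -(innerₗ E)) Real.continuous_fourierChar continuous_inner.neg hint
    exact h
  simp only [besselEval_apply]
  refine ae_eq_of_integral_contDiff_smul_eq ((Lp.memLp _).locallyIntegrable (by norm_num))
    hcont.locallyIntegrable fun g hg hgc => ?_
  have hg₁ : HasCompactSupport (Complex.ofRealCLM ∘ g) := hgc.comp_left rfl
  have hg₂ : ContDiff ℝ ∞ (Complex.ofRealCLM ∘ g) := by fun_prop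
  set φ : SchwartzMap E ℂ := hg₁.toSchwartzMap hg₂
  have h1 : Lp.toTemperedDistribution (besselL2 E F hs0 f) φ
      = 𝓕 (Lp.toTemperedDistribution (besselL2 E F hs0 f)) (𝓕⁻ φ) := by
    rw [TemperedDistribution.fourier_apply, fourier_fourierInv_eq]
  rw [Lp.fourier_toTemperedDistribution_eq, Lp.toTemperedDistribution_apply,
    Lp.toTemperedDistribution_apply, fourier_besselL2] at h1
  have h2 : ∫ ξ, (𝓕⁻ φ) ξ • ((memLp_top_besselSymbol E hs0).toLp • 𝓕 f : Lp F 2 volume) ξ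
      = ∫ ξ, (𝓕⁻ φ) ξ • (besselSymbol E s ξ • (𝓕 f : Lp F 2 volume) ξ) := by
    refine integral_congr_ae ?_
    filter_upwards [Lp.coeFn_lpSMul (r := 2) (memLp_top_besselSymbol E hs0).toLp
      (𝓕 f : Lp F 2 volume), (memLp_top_besselSymbol E hs0).coeFn_toLp] with ξ h3 h4
    rw [h3, Pi.smul_apply', h4]
  rw [h2, integral_fourierInv_smul_eq_of_integrable φ hint] at h1
  simpa [φ] using h1

end Bessel

/-! ### Passing from inner products to bilinear forms -/

section Forms

variable {X : Type*} [AddCommGroup X] [Module ℝ X]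

/-- A positive definite symmetric bilinear form, as an inner product. -/
@[reducible] noncomputable def LinearMap.BilinForm.innerCore (b : LinearMap.BilinForm ℝ X)
    (hsymm : ∀ u v, b u v = b v u) (hpos : ∀ u, u ≠ 0 → 0 < b u u) :
    InnerProductSpace.Core ℝ X where
  inner u v := b u v
  conj_inner_symm u v := hsymm v u
  re_inner_nonneg u := by
    rcases eq_or_ne u 0 with rfl | hu
    · simp
    · exact (hpos u hu).le
  add_left u v z := by simp
  smul_left u v c := by simp
  definite u hu := by
    by_contra h
    exact (hpos u h).ne' hu

/-- Version of `HasCompactSublevels.exists_eigenbasis` for two bilinear forms, the second one in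
the role of the inner product. -/
theorem exists_eigenbasis_of_forms (B b : LinearMap.BilinForm ℝ X)
    (hBsymm : ∀ u v, B u v = B v u) (hBpos : ∀ u, u ≠ 0 → 0 < B u u)
    (hbsymm : ∀ u v, b u v = b v u) (hbpos : ∀ u, u ≠ 0 → 0 < b u u)
    (hc : ∀ (R : ℝ) (u : ℕ → X), (∀ n, B (u n) (u n) ≤ R) →
      ∃ (x : X) (φ : ℕ → ℕ), StrictMono φ ∧ B x x ≤ R ∧
        Tendsto (fun n => b (u (φ n) - x) (u (φ n) - x)) atTop (𝓝 0))
    (hinf : ¬ FiniteDimensional ℝ X) :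
    ∃ (lam : ℕ → ℝ) (ζ : ℕ → X), (∀ i j, b (ζ i) (ζ j) = if i = j then 1 else 0) ∧
      (∀ i Φ, B (ζ i) Φ = lam i * b (ζ i) Φ) ∧ Monotone lam ∧ Tendsto lam atTop atTop ∧
      (∀ V, Tendsto (fun N => b (V - ∑ i ∈ Finset.range N, b V (ζ i) • ζ i)
        (V - ∑ i ∈ Finset.range N, b V (ζ i) • ζ i)) atTop (𝓝 0)) ∧
      (∀ V, Tendsto (fun N => B (V - ∑ i ∈ Finset.range N, b V (ζ i) • ζ i)
        (V - ∑ i ∈ Finset.range N, b V (ζ i) • ζ i)) atTop (𝓝 0)) := by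
  let core := b.innerCore hbsymm hbpos
  let : NormedAddCommGroup X := core.toNormedAddCommGroup
  let : InnerProductSpace ℝ X := .ofCore core.toCore
  have hnorm : ∀ x : X, ‖x‖ ^ 2 = b x x := fun x => (real_inner_self_eq_norm_sq x).symm
  have hc' : HasCompactSublevels B := by
    intro R u hu
    obtain ⟨x, φ, hφ, hx, hlim⟩ := hc R u hu
    refine ⟨x, φ, hφ, hx, ?_⟩
    rw [tendsto_iff_norm_sub_tendsto_zero]
    have h := hlim.sqrt
    simp only [← hnorm, Real.sqrt_sq (norm_nonneg _), Real.sqrt_zero] at h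
    exact h
  obtain ⟨lam, ζ, hon, heig, hmono, hlim, h1, h2⟩ := hc'.exists_eigenbasis hBsymm hBpos hinf
  refine ⟨lam, ζ, orthonormal_iff_ite.1 hon, heig, hmono, hlim, fun V => ?_, h2⟩
  have h3 := (h1 V).pow 2
  simp only [hnorm] at h3
  simpa using! h3

/-- Coefficients of expansions along an orthogonal system are determined by orthogonality. -/
theorem coeff_eq_of_tendsto (b : LinearMap.BilinForm ℝ X)
    (hsymm : ∀ u v, b u v = b v u) (hnonneg : ∀ u, 0 ≤ b u u) {e : ℕ → X} {a : ℕ → ℝ}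
    (he : ∀ i j, b (e i) (e j) = if i = j then a j else 0) (ha : ∀ i, a i ≠ 0) (V : X) (c : ℕ → ℝ)
    (h : Tendsto (fun N : ℕ => √(b (V - ∑ i ∈ Finset.range N, c i • e i)
      (V - ∑ i ∈ Finset.range N, c i • e i))) atTop (𝓝 0)) (j : ℕ) :
    c j = (a j)⁻¹ * b V (e j) := by
  have hev : ∀ᶠ N in atTop, |b V (e j) - c j * a j|
      ≤ √(b (V - ∑ i ∈ Finset.range N, c i • e i) (V - ∑ i ∈ Finset.range N, c i • e i))
        * √(b (e j) (e j)) := by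
    filter_upwards [eventually_gt_atTop j] with N hN
    have h1 : b (V - ∑ i ∈ Finset.range N, c i • e i) (e j) = b V (e j) - c j * a j := by
      rw [LinearMap.BilinForm.sub_left, LinearMap.BilinForm.sum_left]
      simp only [LinearMap.BilinForm.smul_left, he]
      simp [hN]
    rw [← h1, ← Real.sqrt_mul (hnonneg _)]
    refine Real.abs_le_sqrt ?_
    exact b.apply_sq_le_of_symm hnonneg ⟨fun u v => hsymm u v⟩ _ _
  have h2 : |b V (e j) - c j * a j| ≤ 0 := by
    refine ge_of_tendsto ?_ hev
    simpa using h.mul_const √(b (e j) (e j))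
  have h3 := abs_nonpos_iff.1 h2
  rw [eq_inv_mul_iff_mul_eq₀ (ha j)]
  linarith

/-- Expansions along a `b`-orthonormal sequence converge on the `b`-closure of the vectors whose
expansions converge. -/
theorem tendsto_expansion_of_approx (b : LinearMap.BilinForm ℝ X)
    (hsymm : ∀ u v, b u v = b v u) (hpos : ∀ u, u ≠ 0 → 0 < b u u) {e : ℕ → X}
    (he : ∀ i j, b (e i) (e j) = if i = j then 1 else 0) (V : X)
    (h : ∀ ε > 0, ∃ U : X, b (V - U) (V - U) < ε ∧
      Tendsto (fun N => b (U - ∑ i ∈ Finset.range N, b U (e i) • e i)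
        (U - ∑ i ∈ Finset.range N, b U (e i) • e i)) atTop (𝓝 0)) :
    Tendsto (fun N => √(b (V - ∑ i ∈ Finset.range N, b V (e i) • e i)
        (V - ∑ i ∈ Finset.range N, b V (e i) • e i))) atTop (𝓝 0) := by
  let core := b.innerCore hsymm hpos
  let : NormedAddCommGroup X := core.toNormedAddCommGroup
  let : InnerProductSpace ℝ X := .ofCore core.toCore
  have hnorm : ∀ x : X, √(b x x) = ‖x‖ := fun x => (norm_eq_sqrt_real_inner x).symm
  have hon : Orthonormal ℝ e := orthonormal_iff_ite.2 he
  simp only [hnorm]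
  refine hon.tendsto_sub_sum_range_of_approx V fun ε hε => ?_
  obtain ⟨U, hU, hlim⟩ := h (ε ^ 2) (by positivity)
  refine ⟨U, ?_, ?_⟩
  · rw [← hnorm]
    exact (Real.sqrt_lt' hε).2 hU
  · have h1 := hlim.sqrt
    simp only [hnorm, Real.sqrt_zero] at h1
    exact h1

end Forms

/-! ### Density on the kernel of finitely many functionals -/

/-- A vector near `V` is corrected into the kernel by a multiple of a fixed vector of the dense
subspace on which the functional does not vanish. -/
theorem Submodule.le_closure_inf_ker {H : Type*} [NormedAddCommGroup H] [NormedSpace ℝ H]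
    {S T : Submodule ℝ H} (h : (T : Set H) ⊆ closure S) (l : H →L[ℝ] ℝ) :
    ((T ⊓ l.ker : Submodule ℝ H) : Set H)
      ⊆ closure ((S ⊓ l.ker : Submodule ℝ H) : Set H) := by
  rintro V ⟨hVT, hVl⟩
  have hVl' : l V = 0 := hVl
  by_cases hl : ∀ x ∈ S, l x = 0
  · have h1 : S ⊓ l.ker = S := inf_eq_left.2 hl
    rw [h1]
    exact h hVT
  · push Not at hl
    obtain ⟨x₀, hx₀, hne⟩ := hl
    obtain ⟨u, hu, hlim⟩ := mem_closure_iff_seq_limit.1 (h hVT)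
    refine mem_closure_iff_seq_limit.2 ⟨fun n => u n - (l (u n) / l x₀) • x₀, fun n => ?_, ?_⟩
    · refine ⟨S.sub_mem (hu n) (S.smul_mem _ hx₀), ?_⟩
      change l (u n - (l (u n) / l x₀) • x₀) = 0
      rw [map_sub, map_smul, smul_eq_mul, div_mul_cancel₀ _ hne, sub_self]
    · have h1 := hlim.sub ((((l.continuous.tendsto V).comp hlim).div_const (l x₀)).smul_const x₀)
      simpa [hVl'] using! h1

/-- A dense subspace stays dense in the common kernel of finitely many continuous functionals. -/
theorem Submodule.le_closure_inf_iInf_ker {H : Type*} [NormedAddCommGroup H] [NormedSpace ℝ H]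
    {S : Submodule ℝ H} (h : Dense (S : Set H)) (l : ℕ → H →L[ℝ] ℝ) (k : ℕ) :
    {V : H | ∀ i < k, l i V = 0} ⊆ closure {V : H | V ∈ S ∧ ∀ i < k, l i V = 0} := by
  obtain ⟨K, hK0, hK1⟩ : ∃ K : ℕ → Submodule ℝ H, K 0 = ⊤ ∧ ∀ n, K (n + 1) = K n ⊓ (l n).ker :=
    ⟨fun n => Nat.rec ⊤ (fun i T => T ⊓ (l i).ker) n, rfl, fun _ => rfl⟩
  have hK : ∀ n V, V ∈ K n ↔ ∀ i < n, l i V = 0 := by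
    intro n V
    induction n with
    | zero => simp [hK0]
    | succ n ih =>
      rw [hK1, Submodule.mem_inf, ih, Nat.forall_lt_succ_right]
      rfl
  have key : ∀ n, (K n : Set H) ⊆ closure ((S ⊓ K n : Submodule ℝ H) : Set H) := by
    intro n
    induction n with
    | zero =>
      rw [hK0, inf_top_eq, h.closure_eq]
      exact Set.subset_univ _
    | succ n ih =>
      have h1 := Submodule.le_closure_inf_ker ih (l n)
      rwa [inf_assoc, ← hK1] at h1
  intro V hV
  refine closure_mono ?_ (key k ((hK k V).2 hV))
  rintro W ⟨hW, hWK⟩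
  exact ⟨hW, (hK k W).1 hWK⟩

/-! ### Weak compactness -/

section Weak

variable {H : Type*} [NormedAddCommGroup H] [InnerProductSpace ℝ H]

/-- Bounded sequences in a separable Hilbert space have weakly convergent subsequences. -/
theorem exists_subseq_tendsto_weakly [CompleteSpace H] [TopologicalSpace.SeparableSpace H]
    {f : ℕ → H} {R : ℝ} (hf : ∀ n, ‖f n‖ ≤ R) :
    ∃ (x : H) (φ : ℕ → ℕ), StrictMono φ ∧
      ∀ l : StrongDual ℝ H, Tendsto (fun n => l (f (φ n))) atTop (𝓝 (l x)) := by
  have hmem : ∀ n, StrongDual.toWeakDual (InnerProductSpace.toDual ℝ H (f n))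
      ∈ WeakDual.toStrongDual ⁻¹' Metric.closedBall (0 : StrongDual ℝ H) R := by
    intro n
    simpa using hf n
  obtain ⟨y, -, φ, hφ, hlim⟩ := WeakDual.isSeqCompact_closedBall ℝ H 0 R hmem
  refine ⟨(InnerProductSpace.toDual ℝ H).symm (WeakDual.toStrongDual y), φ, hφ, fun l => ?_⟩
  obtain ⟨z, rfl⟩ := (InnerProductSpace.toDual ℝ H).surjective l
  have h1 := ((WeakDual.eval_continuous z).tendsto y).comp hlim
  simp only [InnerProductSpace.toDual_apply_apply]
  rw [real_inner_comm, InnerProductSpace.toDual_symm_apply]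
  refine h1.congr fun n => ?_
  exact real_inner_comm _ _

theorem tendsto_clm_of_tendsto_weakly {H V : Type*} [NormedAddCommGroup H] [NormedSpace ℝ H]
    [NormedAddCommGroup V] [NormedSpace ℝ V]
    [FiniteDimensional ℝ V] {f : ℕ → H} {x : H}
    (h : ∀ l : StrongDual ℝ H, Tendsto (fun n => l (f n)) atTop (𝓝 (l x))) (A : H →L[ℝ] V) :
    Tendsto (fun n => A (f n)) atTop (𝓝 (A x)) := by
  let e := (Module.finBasis ℝ V).equivFunL
  have h1 : Tendsto (fun n => e (A (f n))) atTop (𝓝 (e (A x))) :=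
    tendsto_pi_nhds.2 fun i =>
      h ((ContinuousLinearMap.proj (φ := fun _ => ℝ) i) ∘L e.toContinuousLinearMap ∘L A)
  have h2 := (e.symm.continuous.tendsto _).comp h1
  simpa [Function.comp_def] using h2

end Weak

/-! ### The space `H^s(Ω)` as an image of `L²(ℝ³)` -/

section Sobolev

/-- Complex `3 × 3` matrices with the Frobenius norm. -/
abbrev Mat3C : Type := EuclideanSpace ℂ (Fin 3 × Fin 3)

/-- The symmetrized real part of a complex matrix, a left inverse of `complexify`. -/
noncomputable def symRealPartLin : Mat3C →ₗ[ℝ] Sym3 where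
  toFun A := ⟨WithLp.toLp 2 (fun p => ((A p).re + (A p.swap).re) / 2), by
    intro i j
    simp [add_comm]⟩
  map_add' A B := by
    ext p
    simp
    ring
  map_smul' c A := by
    ext p
    simp
    ring

/-- `symRealPartLin` as a continuous linear map. -/
noncomputable def symRealPart : Mat3C →L[ℝ] Sym3 := symRealPartLin.toContinuousLinearMap

theorem symRealPart_complexify (A : Sym3) : symRealPart (complexify A) = A := by
  ext ⟨i, j⟩
  change (((A : EuclideanSpace ℝ (Fin 3 × Fin 3)) (i, j))
    + ((A : EuclideanSpace ℝ (Fin 3 × Fin 3)) (j, i))) / 2 = _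
  rw [A.2 i j]
  ring

/-- `L²(ℝ³, ℂ^{3 × 3})`. -/
abbrev L2C : Type := Lp Mat3C 2 (volume : Measure E3)

theorem finrank_E3_lt {s : ℝ} (hs : 3 / 2 < s) : (Module.finrank ℝ E3 : ℝ) < 2 * s := by
  rw [finrank_euclideanSpace_fin]
  push_cast
  linarith

/-- The real matrix field on `ℝ³` with Bessel potential `f`; it extends an element of `H^s(Ω)`
when `f` belongs to `hsSource`. -/
noncomputable def hsExt {s : ℝ} (hs : 0 ≤ s) : L2C →L[ℝ] Lp Sym3 2 (volume : Measure E3) :=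
  symRealPart.compLpL 2 volume ∘L (besselL2 E3 Mat3C hs).restrictScalars ℝ

/-- The restriction to `Ω` of `hsExt f`. -/
noncomputable def hsRestrict (Ω : Set E3) {s : ℝ} (hs : 0 ≤ s) : L2C →L[ℝ] L2Sym Ω :=
  LpToLpRestrictCLM E3 Sym3 ℝ volume 2 Ω ∘L hsExt hs

/-- The closed subspace of those `f ∈ L²` for which `𝓕⁻¹ (1 + |·|²)^{-s/2} 𝓕 f` is real and
symmetric; it is isometric to `H^s(ℝ³, 𝒮³)`. -/
noncomputable def hsSource {s : ℝ} (hs : 0 ≤ s) : Submodule ℝ L2C :=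
  ((besselL2 E3 Mat3C hs).restrictScalars ℝ - complexify.compLpL 2 volume ∘L hsExt hs).ker

theorem isClosed_hsSource {s : ℝ} (hs : 0 ≤ s) : IsClosed (hsSource hs : Set L2C) :=
  ContinuousLinearMap.isClosed_ker _

/-- The potential `f` determines the extension `U`, and hence the restriction `u`. -/
theorem isHsExtension_iff {Ω : Set E3} {s : ℝ} (hs : 0 ≤ s) {u : L2Sym Ω}
    {U : Lp Sym3 2 (volume : Measure E3)} {f : L2C} :
    IsHsExtension Ω s u U f ↔ f ∈ hsSource hs ∧ hsExt hs f = U ∧ hsRestrict Ω hs f = u := by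
  have hleft : ∀ U : Lp Sym3 2 (volume : Measure E3),
      symRealPart.compLpL 2 volume (complexify.compLp U) = U := by
    intro U
    refine Lp.ext ?_
    filter_upwards [symRealPart.coeFn_compLpL (complexify.compLp U), complexify.coeFn_compLp U]
      with x h1 h2
    rw [h1, h2, symRealPart_complexify]
  have hmem : f ∈ hsSource hs ↔ besselL2 E3 Mat3C hs f = complexify.compLp (hsExt hs f) := by
    rw [hsSource, LinearMap.mem_ker]
    exact sub_eq_zero
  have hres : ∀ g : L2C, hsRestrict Ω hs g = u ↔ hsExt hs g =ᵐ[volume.restrict Ω] u := by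
    intro g
    have h1 := LpToLpRestrictCLM_coeFn ℝ Ω (hsExt hs g) (μ := volume)
    rw [Lp.ext_iff]
    exact ⟨fun h => h1.symm.trans h, fun h => h1.trans h⟩
  rw [IsHsExtension, ← besselL2_eq_iff hs, hmem, hres]
  constructor
  · rintro ⟨h1, h2⟩
    have h3 : hsExt hs f = U := by
      change symRealPart.compLpL 2 volume (besselL2 E3 Mat3C hs f) = U
      rw [h2, hleft]
    rw [h3]
    exact ⟨h2, rfl, h1⟩
  · rintro ⟨h1, h2, h3⟩
    rw [h2] at h1 h3
    exact ⟨h3, h1⟩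

/-- The surjection `hsSource → H^s(Ω)` whose quotient norm is the norm of `H^s(Ω)`. -/
noncomputable def toHs (Ω : Set E3) {s : ℝ} (hs : 0 ≤ s) : hsSource hs →ₗ[ℝ] Hs Ω s :=
  ((hsRestrict Ω hs).toLinearMap ∘ₗ (hsSource hs).subtype).codRestrict (Hs Ω s)
    fun f => ⟨_, f, (isHsExtension_iff hs).2 ⟨f.2, rfl, rfl⟩⟩

theorem coe_toHs {Ω : Set E3} {s : ℝ} (hs : 0 ≤ s) (f : hsSource hs) :
    (toHs Ω hs f : L2Sym Ω) = hsRestrict Ω hs f := rfl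

theorem hsNorm_toHs_le {Ω : Set E3} {s : ℝ} (hs : 0 ≤ s) (f : hsSource hs) :
    hsNorm (toHs Ω hs f) ≤ ‖f‖ :=
  csInf_le ⟨0, by rintro _ ⟨U, g, -, rfl⟩; exact norm_nonneg g⟩
    ⟨_, f, (isHsExtension_iff hs).2 ⟨f.2, rfl, rfl⟩, rfl⟩

theorem exists_toHs_eq {Ω : Set E3} {s : ℝ} (hs : 0 ≤ s) (u : Hs Ω s) :
    ∃ f : hsSource hs, toHs Ω hs f = u ∧ ‖f‖ < hsNorm u + 1 := by
  have hne : {r | ∃ U f, IsHsExtension Ω s (u : L2Sym Ω) U f ∧ r = ‖f‖}.Nonempty := by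
    obtain ⟨U, f, h⟩ := u.2
    exact ⟨_, U, f, h, rfl⟩
  obtain ⟨_, ⟨U, f, h, rfl⟩, hlt⟩ := Real.lt_sInf_add_pos hne one_pos
  have h1 := (isHsExtension_iff hs).1 h
  exact ⟨⟨f, h1.1⟩, Subtype.ext h1.2.2, hlt⟩

/-- The embedding `H^s(Ω) → L²(Ω)`, `s > 3/2`, turns weak into strong convergence: the values of
the extensions at a fixed point are bounded functionals of `f`, so that they converge pointwise
and boundedly on the bounded set `Ω`. -/
theorem tendsto_hsRestrict {Ω : Set E3} (hΩ : Bornology.IsBounded Ω) {s : ℝ} (hs : 3 / 2 < s)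
    (hs0 : 0 ≤ s) {f : ℕ → L2C} {R : ℝ} (hf : ∀ n, ‖f n‖ ≤ R) {g : L2C}
    (hlim : ∀ l : StrongDual ℝ L2C, Tendsto (fun n => l (f n)) atTop (𝓝 (l g))) :
    Tendsto (fun n => hsRestrict Ω hs0 (f n)) atTop (𝓝 (hsRestrict Ω hs0 g)) := by
  have hs' := finrank_E3_lt hs
  obtain ⟨C, hC0, hC⟩ := exists_norm_besselEval_le (E := E3) (F := Mat3C) hs'
  let P : E3 → L2C →L[ℝ] Sym3 := fun x =>
    symRealPart ∘L (besselEval E3 Mat3C hs' x).restrictScalars ℝ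
  have hP : ∀ x h, ‖P x h‖ ≤ ‖symRealPart‖ * (C * ‖h‖) := fun x h =>
    (symRealPart.le_opNorm _).trans (mul_le_mul_of_nonneg_left (hC x h) symRealPart.opNorm_nonneg)
  have hae : ∀ h : L2C, hsRestrict Ω hs0 h =ᵐ[volume.restrict Ω] fun x => P x h := by
    intro h
    filter_upwards [LpToLpRestrictCLM_coeFn ℝ Ω (hsExt hs0 h) (μ := volume),
      ae_restrict_of_ae (symRealPart.coeFn_compLpL (besselL2 E3 Mat3C hs0 h)),
      ae_restrict_of_ae (besselL2_ae_eq hs0 hs' h)] with x h1 h2 h3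
    refine h1.trans (h2.trans ?_)
    rw [h3]
    rfl
  have : IsFiniteMeasure (volume.restrict Ω) :=
    ⟨by rw [Measure.restrict_apply_univ]; exact hΩ.measure_lt_top⟩
  have hsq : ∀ n, ‖hsRestrict Ω hs0 (f n) - hsRestrict Ω hs0 g‖ ^ 2
      = ∫ x in Ω, ‖P x (f n - g)‖ ^ 2 := by
    intro n
    rw [← map_sub]
    refine (real_inner_self_eq_norm_sq (hsRestrict Ω hs0 (f n - g))).symm.trans ?_
    rw [L2.inner_def]
    refine integral_congr_ae ?_
    filter_upwards [hae (f n - g)] with x hx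
    rw [hx, real_inner_self_eq_norm_sq]
  have hint : Tendsto (fun n => ∫ x in Ω, ‖P x (f n - g)‖ ^ 2) atTop (𝓝 (∫ x in Ω, (0 : ℝ))) := by
    refine tendsto_integral_of_dominated_convergence
      (fun _ => (‖symRealPart‖ * (C * (R + ‖g‖))) ^ 2) (fun n => ?_) (integrable_const _)
      (fun n => ae_of_all _ fun x => ?_) (ae_of_all _ fun x => ?_)
    · exact (((Lp.aestronglyMeasurable _).congr (hae (f n - g))).norm).pow 2
    · rw [Real.norm_of_nonneg (by positivity)]
      have h1 : ‖f n - g‖ ≤ R + ‖g‖ := (norm_sub_le _ _).trans (by linarith [hf n])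
      exact pow_le_pow_left₀ (norm_nonneg _)
        ((hP x _).trans (by gcongr)) 2
    · have h1 := tendsto_clm_of_tendsto_weakly hlim (P x)
      have h2 := ((h1.sub_const (P x g)).norm).pow 2
      simpa using h2
  rw [tendsto_iff_norm_sub_tendsto_zero]
  have h3 := hint.sqrt
  simp only [← hsq, integral_zero, Real.sqrt_zero] at h3
  exact h3.congr fun n => Real.sqrt_sq (norm_nonneg (hsRestrict Ω hs0 (f n) - hsRestrict Ω hs0 g))

/-- Rellich's theorem, with the control of the scalar product `B` at the limit. -/
theorem IsHsScalarProduct.exists_subseq_tendsto {Ω : Set E3} (hΩ : Bornology.IsBounded Ω)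
    {s : ℝ} (hs : 3 / 2 < s) {B : LinearMap.BilinForm ℝ (Hs Ω s)} (hB : IsHsScalarProduct Ω s B)
    {R : ℝ} {u : ℕ → Hs Ω s} (hu : ∀ n, B (u n) (u n) ≤ R) :
    ∃ (x : Hs Ω s) (φ : ℕ → ℕ), StrictMono φ ∧ B x x ≤ R ∧
      Tendsto (fun n => (u (φ n) : L2Sym Ω)) atTop (𝓝 (x : L2Sym Ω)) := by
  have hs0 : 0 ≤ s := by linarith
  obtain ⟨c, C, hc, hequiv⟩ := hB.equiv
  have hnonneg : ∀ v, 0 ≤ B v v := by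
    intro v
    rcases eq_or_ne v 0 with rfl | hv
    · simp
    · exact (hB.pos v hv).le
  choose f hf hfn using fun n => exists_toHs_eq hs0 (u n)
  -- The lower bound for `B` bounds the norms in `H^s(Ω)`, hence those of almost optimal
  -- extensions.
  have hbound : ∀ n, ‖(f n : L2C)‖ ≤ √R / c + 1 := by
    intro n
    have h1 : hsNorm (u n) ≤ √R / c := by
      rw [le_div_iff₀ hc, mul_comm]
      exact (hequiv (u n)).1.trans (Real.sqrt_le_sqrt (hu n))
    exact (hfn n).le.trans (by linarith)
  have : CompleteSpace (hsSource hs0) := (isClosed_hsSource hs0).completeSpace_coe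
  have : Fact ((2 : ENNReal) ≠ ⊤) := ⟨by norm_num⟩
  have : SecondCountableTopology L2C := inferInstance
  have : SecondCountableTopology (hsSource hs0) := TopologicalSpace.Subtype.secondCountableTopology _
  obtain ⟨g, φ, hφ, hlim⟩ := exists_subseq_tendsto_weakly (H := hsSource hs0) (f := f) hbound
  refine ⟨toHs Ω hs0 g, φ, hφ, ?_, ?_⟩
  · -- `B(·, y)` is bounded on `hsSource`, so `B(u_n, y) → B(x, y)`; take `y = x`.
    set x := toHs Ω hs0 g with hx
    let l : StrongDual ℝ (hsSource hs0) :=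
      ((B x) ∘ₗ toHs Ω hs0).mkContinuous (√(B x x) * |C|) fun v => by
        have h1 : |B x (toHs Ω hs0 v)| ≤ √(B x x) * √(B (toHs Ω hs0 v) (toHs Ω hs0 v)) := by
          rw [← Real.sqrt_mul (hnonneg _)]
          exact Real.abs_le_sqrt (B.apply_sq_le_of_symm hnonneg ⟨fun u v => hB.symm u v⟩ _ _)
        have h2 : √(B (toHs Ω hs0 v) (toHs Ω hs0 v)) ≤ |C| * ‖v‖ := by
          refine (hequiv _).2.trans ?_
          have h3 := hsNorm_toHs_le (Ω := Ω) hs0 v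
          have h4 : 0 ≤ hsNorm (toHs Ω hs0 v) :=
            Real.sInf_nonneg (by rintro _ ⟨_, _, _, rfl⟩; exact norm_nonneg _)
          exact (mul_le_mul_of_nonneg_right (le_abs_self C) h4).trans
            (mul_le_mul_of_nonneg_left h3 (abs_nonneg C))
        rw [mul_assoc]
        exact h1.trans (mul_le_mul_of_nonneg_left h2 (Real.sqrt_nonneg _))
    have h1 : Tendsto (fun n => B x (u (φ n))) atTop (𝓝 (B x x)) := by
      have h2 := hlim l
      simp only [l, LinearMap.mkContinuous_apply, LinearMap.comp_apply, hf] at h2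
      exact h2
    have h2 : B x x ≤ √(B x x) * √R := by
      refine le_of_tendsto h1 (Eventually.of_forall fun n => ?_)
      rw [← Real.sqrt_mul (hnonneg _)]
      refine (le_abs_self _).trans (Real.abs_le_sqrt ?_)
      exact (B.apply_sq_le_of_symm hnonneg ⟨fun u v => hB.symm u v⟩ _ _).trans
        (mul_le_mul_of_nonneg_left (hu _) (hnonneg _))
    have hR : 0 ≤ R := (hnonneg (u 0)).trans (hu 0)
    nlinarith [Real.sq_sqrt hR, Real.sq_sqrt (hnonneg x), Real.sqrt_nonneg R,
      Real.sqrt_nonneg (B x x), sq_nonneg (√(B x x) - √R)]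
  · have h1 := tendsto_hsRestrict hΩ hs hs0 (f := fun n => (f (φ n) : L2C)) (g := g)
      (fun n => hbound (φ n)) fun l => hlim (l ∘L (hsSource hs0).subtypeL)
    refine h1.congr fun n => ?_
    rw [← coe_toHs, hf]

/-- Schwartz functions restrict to elements of `H^s(Ω)`, and they are dense in `L²(Ω)`. -/
theorem dense_Hs (Ω : Set E3) (hΩ : Bornology.IsBounded Ω) (s : ℝ) :
    Dense (Hs Ω s : Set (L2Sym Ω)) := by
  have : IsFiniteMeasure (volume.restrict Ω) :=
    ⟨by rw [Measure.restrict_apply_univ]; exact hΩ.measure_lt_top⟩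
  refine Dense.mono ?_ (SchwartzMap.denseRange_toLpCLM (E := E3) (F := Sym3) (p := 2)
    (μ := volume.restrict Ω) (by norm_num))
  rintro _ ⟨ψ, rfl⟩
  obtain ⟨f, hf⟩ := SchwartzMap.memSobolev (s := s) (p := 2)
    (SchwartzMap.postcompCLM complexify ψ)
  refine ⟨ψ.toLp 2 volume, f, ?_, ?_⟩
  · filter_upwards [ae_restrict_of_ae (ψ.coeFn_toLp 2 volume),
      ψ.coeFn_toLp 2 (volume.restrict Ω)] with x h1 h2
    rw [h1]
    exact h2.symm
  · rw [← hf, ← Lp.toTemperedDistribution_toLp_eq (p := 2)]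
    congr 2

end Sobolev

/-! ### The form `(·,·)_D` and the spaces `V_k` -/

section InnerD

variable {Ω : Set E3} (D : Sym3 →ₗ[ℝ] Sym3)

theorem innerD_eq_inner (ξ η : L2Sym Ω) :
    innerD D ξ η = inner ℝ (D.toContinuousLinearMap.compLpL 2 (volume.restrict Ω) ξ) η := by
  rw [L2.inner_def]
  refine integral_congr_ae ?_
  filter_upwards [D.toContinuousLinearMap.coeFn_compLpL (p := 2) ξ] with x hx
  rw [hx]
  rfl

/-- `innerD` as a bilinear form. -/
noncomputable def innerDForm (Ω : Set E3) : LinearMap.BilinForm ℝ (L2Sym Ω) :=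
  (innerₗ (L2Sym Ω)) ∘ₗ (D.toContinuousLinearMap.compLpL 2 (volume.restrict Ω)).toLinearMap

theorem innerDForm_apply (ξ η : L2Sym Ω) : innerDForm D Ω ξ η = innerD D ξ η :=
  (innerD_eq_inner D ξ η).symm

theorem continuous_innerDForm_self : Continuous fun ξ => innerDForm D Ω ξ ξ := by
  let T := D.toContinuousLinearMap.compLpL 2 (volume.restrict Ω)
  have h : Continuous fun ξ : L2Sym Ω => (inner ℝ (T ξ) ξ : ℝ) :=
    Continuous.inner (𝕜 := ℝ) T.continuous continuous_id
  exact h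

/-- The continuous functional `(·, η)_D`. -/
noncomputable def innerDFunctional (η : L2Sym Ω) : L2Sym Ω →L[ℝ] ℝ :=
  innerSL ℝ η ∘L D.toContinuousLinearMap.compLpL 2 (volume.restrict Ω)

theorem innerDFunctional_apply (ξ η : L2Sym Ω) : innerDFunctional D η ξ = innerDForm D Ω ξ η := by
  rw [innerDForm_apply, innerD_eq_inner]
  exact real_inner_comm (F := L2Sym Ω) _ _

variable {D}

theorem innerDForm_symm (hD : ∀ A A' : Sym3, inner ℝ (D A) A' = inner ℝ A (D A'))
    (ξ η : L2Sym Ω) : innerDForm D Ω ξ η = innerDForm D Ω η ξ := by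
  rw [innerDForm_apply, innerDForm_apply]
  refine integral_congr_ae (ae_of_all _ fun x => ?_)
  change inner ℝ (D (ξ x)) (η x) = inner ℝ (D (η x)) (ξ x)
  rw [hD, real_inner_comm]

theorem innerDForm_pos (hD : ∀ A : Sym3, A ≠ 0 → 0 < inner ℝ (D A) A) (ξ : L2Sym Ω)
    (hξ : ξ ≠ 0) : 0 < innerDForm D Ω ξ ξ := by
  have hnonneg : ∀ A : Sym3, 0 ≤ inner ℝ (D A) A := by
    intro A
    rcases eq_or_ne A 0 with rfl | hA
    · simp
    · exact (hD A hA).le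
  have hint : Integrable (fun x => inner ℝ (D (ξ x)) (ξ x)) (volume.restrict Ω) := by
    refine (L2.integrable_inner (𝕜 := ℝ)
      (D.toContinuousLinearMap.compLpL 2 (volume.restrict Ω) ξ) ξ).congr ?_
    filter_upwards [D.toContinuousLinearMap.coeFn_compLpL (p := 2) ξ] with x hx
    rw [hx]
    rfl
  rw [innerDForm_apply]
  refine (integral_nonneg fun x => hnonneg (ξ x)).lt_of_ne fun h0 => hξ ?_
  have h1 := (integral_eq_zero_iff_of_nonneg (fun x => hnonneg (ξ x)) hint).1 h0.symm
  rw [Lp.eq_zero_iff_ae_eq_zero]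
  filter_upwards [h1] with x hx
  by_contra hne
  exact (hD _ hne).ne' hx

theorem mem_Vk_iff {w : ℕ → L2Vec Ω × L2Grad Ω} {k : ℕ} {ξ : L2Sym Ω} :
    ξ ∈ Vk Ω D w k ↔ ∀ i < k, innerDForm D Ω ξ (strain (w i)) = 0 := by
  constructor
  · intro h i hi
    rw [innerDForm_apply]
    exact h _ (Submodule.subset_span ⟨i, hi, rfl⟩)
  · intro h η hη
    rw [← innerDForm_apply]
    have hle : Submodule.span ℝ {e | ∃ i < k, e = strain (w i)}
        ≤ LinearMap.ker (innerDForm D Ω ξ) := by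
      rw [Submodule.span_le]
      rintro _ ⟨i, hi, rfl⟩
      exact h i hi
    exact hle hη

variable (D) in
/-- `V_k^s` as a subspace of `H^s(Ω)`: the common kernel of the functionals `(·, ε(w_i))_D`. -/
noncomputable def VksSubmodule (w : ℕ → L2Vec Ω × L2Grad Ω) (k : ℕ) (s : ℝ) :
    Submodule ℝ (Hs Ω s) :=
  LinearMap.ker (LinearMap.pi fun i : Fin k =>
    (innerDForm D Ω).flip (strain (w i)) ∘ₗ (Hs Ω s).subtype)

theorem mem_VksSubmodule {w : ℕ → L2Vec Ω × L2Grad Ω} {k : ℕ} {s : ℝ} {V : Hs Ω s} :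
    V ∈ VksSubmodule D w k s ↔ V ∈ Vks Ω D w k s := by
  change _ ↔ (V : L2Sym Ω) ∈ Vk Ω D w k
  rw [mem_Vk_iff, VksSubmodule, LinearMap.mem_ker, funext_iff]
  exact ⟨fun h i hi => h ⟨i, hi⟩, fun h i => h i i.2⟩

/-- `V_k^s` is dense in `V_k`. -/
theorem Vk_subset_closure {w : ℕ → L2Vec Ω × L2Grad Ω} {k : ℕ} {s : ℝ}
    (hΩ : Bornology.IsBounded Ω) :
    Vk Ω D w k ⊆ closure {V : L2Sym Ω | V ∈ Hs Ω s ∧ V ∈ Vk Ω D w k} := by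
  have h := Submodule.le_closure_inf_iInf_ker (H := L2Sym Ω) (S := Hs Ω s)
    (dense_Hs Ω hΩ s)
    (fun i => innerDFunctional D (strain (w i))) k
  have h1 : ∀ V, V ∈ Vk Ω D w k ↔ ∀ i < k, innerDFunctional D (strain (w i)) V = 0 := by
    intro V
    simp only [mem_Vk_iff, innerDFunctional_apply]
  intro V hV
  simp only [h1]
  exact h ((h1 V).1 hV)

/-- The indicator functions of disjoint sets of positive measure are orthogonal. -/
theorem not_finiteDimensional_Lp_two {α E : Type*} [MeasurableSpace α] {μ : Measure α}
    [IsFiniteMeasure μ] [NormedAddCommGroup E] [InnerProductSpace ℝ E] [CompleteSpace E]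
    [Nontrivial E] {S : ℕ → Set α} (hS : ∀ n, MeasurableSet (S n))
    (hd : Pairwise (Function.onFun Disjoint S)) (hpos : ∀ n, μ (S n) ≠ 0) :
    ¬ FiniteDimensional ℝ (Lp E 2 μ) := by
  obtain ⟨A, hA⟩ := exists_ne (0 : E)
  let e : ℕ → Lp E 2 μ := fun n => indicatorConstLp 2 (hS n) (measure_ne_top μ _) A
  have hinner : ∀ i j, inner ℝ (e i) (e j) = μ.real (S i ∩ S j) • inner ℝ A A :=
    fun i j => L2.inner_indicatorConstLp_indicatorConstLp (𝕜 := ℝ) (hS i) (hS j)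
      (measure_ne_top μ _) (measure_ne_top μ _) A A
  have hli : LinearIndependent ℝ e := by
    refine linearIndependent_of_ne_zero_of_inner_eq_zero (𝕜 := ℝ) (fun i h0 => ?_)
      fun i j hij => ?_
    · have h1 := hinner i i
      rw [h0, inner_zero_left, Set.inter_self] at h1
      refine smul_ne_zero ?_ (inner_self_ne_zero.2 hA) h1.symm
      exact ENNReal.toReal_ne_zero.2 ⟨hpos i, measure_ne_top _ _⟩
    · change inner ℝ (e i) (e j) = 0
      rw [hinner, (hd hij).inter_eq]
      simp
  intro hfin
  have := hli.finite
  exact not_finite ℕ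

theorem not_finiteDimensional_L2Sym (hΩo : IsOpen Ω) (hΩ : Bornology.IsBounded Ω)
    (hne : Ω.Nonempty) : ¬ FiniteDimensional ℝ (L2Sym Ω) := by
  have : IsFiniteMeasure (volume.restrict Ω) :=
    ⟨by rw [Measure.restrict_apply_univ]; exact hΩ.measure_lt_top⟩
  obtain ⟨x₀, hx₀⟩ := hne
  have : Infinite Ω := (infinite_of_mem_nhds x₀ (hΩo.mem_nhds hx₀)).to_subtype
  obtain ⟨U, hUinf, hUo, hUd⟩ := exists_seq_infinite_isOpen_pairwise_disjoint (X := Ω)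
  have hVo : ∀ n, IsOpen (Subtype.val '' U n) := fun n => hΩo.isOpenMap_subtype_val _ (hUo n)
  have : Nontrivial Sym3 := by
    refine ⟨⟨⟨WithLp.toLp 2 fun _ => 1, fun i j => rfl⟩, 0, fun h => ?_⟩⟩
    have h1 := congrArg (fun A : Sym3 => (A : EuclideanSpace ℝ (Fin 3 × Fin 3)) (0, 0)) h
    simp at h1
  refine not_finiteDimensional_Lp_two (fun n => (hVo n).measurableSet)
    (fun i j hij => (Set.disjoint_image_iff Subtype.val_injective).2 (hUd hij)) fun n => ?_
  rw [Measure.restrict_apply (hVo n).measurableSet,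
    Set.inter_eq_left.2 (Subtype.coe_image_subset _ _)]
  exact ((hVo n).measure_pos _ ((hUinf n).nonempty.image _)).ne'

/-- `V_k^s` has finite codimension in the dense subspace `H^s(Ω)` of `L²(Ω)`. -/
theorem not_finiteDimensional_VksSubmodule (hΩo : IsOpen Ω) (hΩ : Bornology.IsBounded Ω)
    (hne : Ω.Nonempty) (w : ℕ → L2Vec Ω × L2Grad Ω) (k : ℕ) (s : ℝ) :
    ¬ FiniteDimensional ℝ (VksSubmodule D w k s) := by
  intro hfin
  refine not_finiteDimensional_L2Sym hΩo hΩ hne ?_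
  have : FiniteDimensional ℝ (Hs Ω s ⧸ VksSubmodule D w k s) :=
    Module.Finite.equiv (LinearMap.quotKerEquivRange _).symm
  have : FiniteDimensional ℝ (Hs Ω s) := Module.Finite.of_submodule_quotient (VksSubmodule D w k s)
  have h1 : Hs Ω s = ⊤ := by
    rw [← SetLike.coe_set_eq, ← (Submodule.closed_of_finiteDimensional (Hs Ω s)).closure_eq,
      (dense_Hs Ω hΩ s).closure_eq]
    rfl
  rw [h1] at this
  exact Module.Finite.equiv (Submodule.topEquiv (R := ℝ) (M := L2Sym Ω))

end InnerD

/-! ### Orthogonal expansions for a pair of forms -/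

section Pair

variable {X : Type*} [AddCommGroup X] [Module ℝ X] {B b : LinearMap.BilinForm ℝ X}
  {lam : ℕ → ℝ} {ζ : ℕ → X}

/-- The partial sums of the expansion are also orthogonal projections for `B`. -/
theorem bilin_expansion_le (hBsymm : ∀ u v, B u v = B v u) (hnonneg : ∀ u, 0 ≤ B u u)
    (hbsymm : ∀ u v, b u v = b v u) (hon : ∀ i j, b (ζ i) (ζ j) = if i = j then 1 else 0)
    (heig : ∀ i Φ, B (ζ i) Φ = lam i * b (ζ i) Φ) (V : X) (N : ℕ) :
    B (∑ i ∈ Finset.range N, b V (ζ i) • ζ i) (∑ i ∈ Finset.range N, b V (ζ i) • ζ i)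
      ≤ B V V := by
  set P := ∑ i ∈ Finset.range N, b V (ζ i) • ζ i with hP
  have h1 : ∀ i < N, b (ζ i) (V - P) = 0 := by
    intro i hi
    rw [hbsymm, hP, LinearMap.BilinForm.sub_left, LinearMap.BilinForm.sum_left]
    simp only [LinearMap.BilinForm.smul_left, hon]
    simp [hi]
  have h2 : B P (V - P) = 0 := by
    conv_lhs => rw [hP]
    rw [LinearMap.BilinForm.sum_left]
    refine Finset.sum_eq_zero fun i hi => ?_
    rw [LinearMap.BilinForm.smul_left, heig, ← hP, h1 i (Finset.mem_range.1 hi)]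
    simp
  have h3 : B V V = B (P + (V - P)) (P + (V - P)) := by rw [add_sub_cancel]
  rw [h3, LinearMap.BilinForm.add_left, LinearMap.BilinForm.add_right,
    LinearMap.BilinForm.add_right, hBsymm (V - P) P, h2]
  linarith [hnonneg (V - P)]

/-- An eigenvector for an eigenvalue outside `lam` would be `b`-orthogonal to all `ζ i`. -/
theorem exists_eq_of_eigenvector (hBsymm : ∀ u v, B u v = B v u)
    (hbsymm : ∀ u v, b u v = b v u) (hbpos : ∀ u, u ≠ 0 → 0 < b u u)
    (heig : ∀ i Φ, B (ζ i) Φ = lam i * b (ζ i) Φ)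
    (hexp : ∀ V, Tendsto (fun N => b (V - ∑ i ∈ Finset.range N, b V (ζ i) • ζ i)
        (V - ∑ i ∈ Finset.range N, b V (ζ i) • ζ i)) atTop (𝓝 0))
    {μ : ℝ} {V : X} (hV : V ≠ 0) (hμ : ∀ Φ, B V Φ = μ * b V Φ) : ∃ i, μ = lam i := by
  by_contra! hne
  have h1 : ∀ i, b V (ζ i) = 0 := by
    intro i
    have h2 : μ * b V (ζ i) = lam i * b V (ζ i) := by
      rw [← hμ, hBsymm, heig, hbsymm]
    have h3 : (μ - lam i) * b V (ζ i) = 0 := by linarith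
    exact (mul_eq_zero.1 h3).resolve_left (sub_ne_zero.2 (hne i))
  have h4 := hexp V
  simp only [h1, zero_smul, Finset.sum_const_zero, sub_zero] at h4
  exact (hbpos V hV).ne' (tendsto_nhds_unique tendsto_const_nhds h4)

end Pair

/-! ### The eigenvalue problem on `V_k^s` -/

theorem tendsto_innerDForm_sub_self {Ω : Set E3} (D : Sym3 →ₗ[ℝ] Sym3) {u : ℕ → L2Sym Ω}
    {x : L2Sym Ω} (h : Tendsto u atTop (𝓝 x)) :
    Tendsto (fun n => innerDForm D Ω (u n - x) (u n - x)) atTop (𝓝 0) := by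
  have h0 : Tendsto (fun n => u n - x) atTop (𝓝 0) := by
    simpa using h.sub_const x
  have h1 : Tendsto (fun n => innerDForm D Ω (u n - x) (u n - x)) atTop
      (𝓝 (innerDForm D Ω 0 0)) := ((continuous_innerDForm_self (Ω := Ω) D).tendsto 0).comp h0
  rwa [map_zero] at h1

/-- Bounded sequences of `V_k^s` have subsequences that converge for `(·,·)_D`. -/
theorem IsHsScalarProduct.exists_subseq_tendsto_VksSubmodule {Ω : Set E3}
    (hΩ : Bornology.IsBounded Ω) {s : ℝ} (hs : 3 / 2 < s) {B : LinearMap.BilinForm ℝ (Hs Ω s)}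
    (hB : IsHsScalarProduct Ω s B) {D : Sym3 →ₗ[ℝ] Sym3} {w : ℕ → L2Vec Ω × L2Grad Ω} {k : ℕ}
    {R : ℝ} {u : ℕ → VksSubmodule D w k s} (hu : ∀ n, B (u n) (u n) ≤ R) :
    ∃ (x : VksSubmodule D w k s) (φ : ℕ → ℕ), StrictMono φ ∧ B x x ≤ R ∧
      Tendsto (fun n => innerDForm D Ω (((u (φ n) - x : VksSubmodule D w k s) : Hs Ω s) : L2Sym Ω)
        ((u (φ n) - x : VksSubmodule D w k s) : Hs Ω s)) atTop (𝓝 0) := by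
  obtain ⟨x, φ, hφ, hx, hlim⟩ := hB.exists_subseq_tendsto hΩ hs hu
  have hxW : x ∈ VksSubmodule D w k s := by
    rw [mem_VksSubmodule]
    refine mem_Vk_iff.2 fun i hi => ?_
    have h1 := ((innerDFunctional D (strain (w i))).continuous.tendsto _).comp hlim
    simp only [Function.comp_def, innerDFunctional_apply] at h1
    refine tendsto_nhds_unique h1 (tendsto_const_nhds.congr fun n => ?_)
    exact (mem_Vk_iff.1 (mem_VksSubmodule.1 (u (φ n)).2) i hi).symm
  exact ⟨⟨x, hxW⟩, φ, hφ, hx, tendsto_innerDForm_sub_self D hlim⟩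

set_option maxHeartbeats 1000000 in
theorem theorem2 (Ω : Set E3) (hΩ_open : IsOpen Ω) (hΩ_bdd : Bornology.IsBounded Ω)
    (hΩ_ne : Ω.Nonempty)
    (D : Sym3 →ₗ[ℝ] Sym3) (hD_symm : ∀ A A' : Sym3, inner ℝ (D A) A' = inner ℝ A (D A'))
    (hD_pos : ∀ A : Sym3, A ≠ 0 → 0 < inner ℝ (D A) A)
    (w : ℕ → L2Vec Ω × L2Grad Ω) (hw : IsElasticEigensystem Ω D w) (k : ℕ)
    (s : ℝ) (hs : 3 / 2 < s)
    (B : LinearMap.BilinForm ℝ (Hs Ω s)) (hB : IsHsScalarProduct Ω s B) :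
    ∃ (lam : ℕ → ℝ) (ζ : ℕ → Hs Ω s),
      -- eigenpairs
      (∀ i, ζ i ∈ Vks Ω D w k s) ∧
      (∀ i, ∀ Φ ∈ Vks Ω D w k s,
        B (ζ i) Φ = lam i * innerD D (ζ i : L2Sym Ω) (Φ : L2Sym Ω)) ∧
      -- every eigenvalue occurs in the list
      (∀ μ : ℝ, (∃ V ∈ Vks Ω D w k s, V ≠ 0 ∧ ∀ Φ ∈ Vks Ω D w k s,
        B V Φ = μ * innerD D (V : L2Sym Ω) (Φ : L2Sym Ω)) → ∃ i, μ = lam i) ∧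
      -- orthonormality in `L²` with respect to `(·,·)_D`
      (∀ i j, innerD D (ζ i : L2Sym Ω) (ζ j : L2Sym Ω) = if i = j then 1 else 0) ∧
      -- the eigenvalues
      0 < lam 0 ∧
      ((∀ V : Hs Ω s, innerD D (V : L2Sym Ω) (V : L2Sym Ω) ≤ B V V) → 1 ≤ lam 0) ∧
      Monotone lam ∧ Tendsto lam atTop atTop ∧
      -- orthonormality of the rescaled eigenfunctions in `H^s`
      (∀ i j, B ((√(lam i))⁻¹ • ζ i) ((√(lam j))⁻¹ • ζ j) = if i = j then 1 else 0) ∧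
      -- bases of `V_k^s` and of `V_k`
      IsBasisOf (fun u v => B u v) (Vks Ω D w k s) ζ ∧
      IsBasisOf (innerD D) (Vk Ω D w k) (fun i => (ζ i : L2Sym Ω)) ∧
      -- the projections do not increase the `H^s` norm
      (∀ (N : ℕ), ∀ φ ∈ Vks Ω D w k s,
        √(B (projN D ζ N φ) (projN D ζ N φ)) ≤ √(B φ φ)) := by
  have hbsymm := innerDForm_symm (Ω := Ω) hD_symm
  have hbpos := innerDForm_pos (Ω := Ω) hD_pos
  have hBnonneg : ∀ V, 0 ≤ B V V := by
    intro V
    rcases eq_or_ne V 0 with rfl | hV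
    · simp
    · exact (hB.pos V hV).le
  have hbnonneg : ∀ V, 0 ≤ innerDForm D Ω V V := by
    intro V
    rcases eq_or_ne V 0 with rfl | hV
    · simp
    · exact (hbpos V hV).le
  set W := VksSubmodule D w k s with hW
  -- The two forms on `V_k^s`.
  set bW : LinearMap.BilinForm ℝ W :=
    (innerDForm D Ω).compl₁₂ ((Hs Ω s).subtype ∘ₗ W.subtype) ((Hs Ω s).subtype ∘ₗ W.subtype)
    with hbW
  set BW : LinearMap.BilinForm ℝ W := B.compl₁₂ W.subtype W.subtype with hBW
  have hbW_apply : ∀ u v : W, bW u v = innerDForm D Ω ((u : Hs Ω s) : L2Sym Ω) (v : Hs Ω s) :=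
    fun _ _ => rfl
  have hBW_apply : ∀ u v : W, BW u v = B u v := fun _ _ => rfl
  have hbWpos : ∀ u, u ≠ 0 → 0 < bW u u := fun u hu => hbpos _ (by simpa using hu)
  have hBWsymm : ∀ u v, BW u v = BW v u := fun u v => hB.symm _ _
  have hbWsymm : ∀ u v, bW u v = bW v u := fun u v => hbsymm _ _
  have hBWpos : ∀ u, u ≠ 0 → 0 < BW u u := fun u hu => hB.pos _ (by simpa using hu)
  obtain ⟨lam, ζ, hon, heig, hmono, htends, hexpb, hexpB⟩ :=
    exists_eigenbasis_of_forms BW bW hBWsymm hBWpos hbWsymm hbWpos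
    (fun R u hu => hB.exists_subseq_tendsto_VksSubmodule hΩ_bdd hs hu)
    (not_finiteDimensional_VksSubmodule hΩ_open hΩ_bdd hΩ_ne w k s)
  have hlampos : ∀ i, 0 < lam i := by
    intro i
    have h1 := heig i (ζ i)
    rw [hon, if_pos rfl, mul_one] at h1
    rw [← h1]
    refine hBWpos _ fun h0 => ?_
    have h2 := hon i i
    rw [h0] at h2
    simp at h2
  have hcoe : ∀ (V : W) (c : ℕ → ℝ) (N : ℕ), ((V - ∑ i ∈ Finset.range N, c i • ζ i : W) : Hs Ω s)
      = (V : Hs Ω s) - ∑ i ∈ Finset.range N, c i • (ζ i : Hs Ω s) := by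
    intro V c N
    simp
  have hcoe2 : ∀ (V : W) (c : ℕ → ℝ) (N : ℕ),
      (((V - ∑ i ∈ Finset.range N, c i • ζ i : W) : Hs Ω s) : L2Sym Ω)
      = ((V : Hs Ω s) : L2Sym Ω) - ∑ i ∈ Finset.range N, c i • ((ζ i : Hs Ω s) : L2Sym Ω) := by
    intro V c N
    simp
  have hon' : ∀ i j, innerDForm D Ω ((ζ i : Hs Ω s) : L2Sym Ω) (ζ j : Hs Ω s)
      = if i = j then 1 else 0 := hon
  have hBon : ∀ i j, B (ζ i : Hs Ω s) (ζ j) = if i = j then lam j else 0 := by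
    intro i j
    rw [← hBW_apply, heig, hon]
    rcases eq_or_ne i j with rfl | h
    · simp
    · simp [h]
  refine ⟨lam, fun i => ζ i, fun i => mem_VksSubmodule.1 (ζ i).2, ?_, ?_, ?_, hlampos 0, ?_,
    hmono, htends, ?_, ⟨fun i => mem_VksSubmodule.1 (ζ i).2, ?_⟩,
    ⟨fun i => mem_VksSubmodule.1 (ζ i).2, ?_⟩, ?_⟩
  · intro i Φ hΦ
    rw [← innerDForm_apply]
    exact heig i ⟨Φ, mem_VksSubmodule.2 hΦ⟩
  · rintro μ ⟨V, hV, hV0, hμ⟩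
    refine exists_eq_of_eigenvector (V := (⟨V, mem_VksSubmodule.2 hV⟩ : W)) hBWsymm hbWsymm hbWpos
      heig hexpb (fun h => hV0 (congrArg Subtype.val h)) fun Φ => ?_
    rw [hbW_apply, innerDForm_apply]
    exact hμ Φ (mem_VksSubmodule.1 Φ.2)
  · intro i j
    rw [← innerDForm_apply]
    exact hon i j
  · intro hle
    have h1 := hle (ζ 0)
    rwa [← innerDForm_apply, hon', if_pos rfl, hBon, if_pos rfl] at h1
  · intro i j
    rw [LinearMap.BilinForm.smul_left, LinearMap.BilinForm.smul_right, hBon]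
    rcases eq_or_ne i j with rfl | h
    · have h1 : √(lam i) ≠ 0 := (Real.sqrt_pos.2 (hlampos i)).ne'
      have h2 := Real.mul_self_sqrt (hlampos i).le
      rw [if_pos rfl, if_pos rfl, ← mul_assoc, ← mul_inv, h2, inv_mul_cancel₀ (hlampos i).ne']
    · simp [h]
  · intro V hV
    refine ⟨fun i => innerDForm D Ω (V : L2Sym Ω) (ζ i : Hs Ω s), ?_, fun c hc => ?_⟩
    · have h1 := (hexpB ⟨V, mem_VksSubmodule.2 hV⟩).sqrt
      simp only [hBW_apply, hcoe, Real.sqrt_zero] at h1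
      exact h1
    · funext j
      have h1 := coeff_eq_of_tendsto B hB.symm hBnonneg hBon (fun i => (hlampos i).ne') V c hc j
      have h2 := heig j ⟨V, mem_VksSubmodule.2 hV⟩
      rw [hBW_apply, hbWsymm] at h2
      rw [h1, hB.symm, h2, inv_mul_cancel_left₀ (hlampos j).ne']
      rfl
  · intro V hV
    simp only [← innerDForm_apply]
    refine ⟨fun i => innerDForm D Ω V (ζ i : Hs Ω s), ?_, fun c hc => ?_⟩
    · refine tendsto_expansion_of_approx (innerDForm D Ω) hbsymm hbpos hon' V fun ε hε => ?_
      obtain ⟨u, hu, hlim⟩ := mem_closure_iff_seq_limit.1 (Vk_subset_closure (s := s) hΩ_bdd hV)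
      have h1 := tendsto_innerDForm_sub_self D hlim
      obtain ⟨n, hn⟩ := (h1.eventually (gt_mem_nhds hε)).exists
      refine ⟨u n, ?_, ?_⟩
      · rwa [← neg_sub, LinearMap.BilinForm.neg_left, LinearMap.BilinForm.neg_right, neg_neg]
      have h2 := hexpb ⟨⟨u n, (hu n).1⟩, mem_VksSubmodule.2 (hu n).2⟩
      simp only [hbW_apply, hcoe2] at h2
      exact h2
    · funext j
      have h1 := coeff_eq_of_tendsto (innerDForm D Ω) hbsymm hbnonneg (a := fun _ => 1)
        hon' (fun i => one_ne_zero) V c hc j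
      rw [h1, inv_one, one_mul]
  · intro N φ hφ
    refine Real.sqrt_le_sqrt ?_
    have h1 := bilin_expansion_le hBWsymm (fun u => hBnonneg u) hbWsymm hon heig
      ⟨φ, mem_VksSubmodule.2 hφ⟩ N
    simp only [hBW_apply, hbW_apply, innerDForm_apply] at h1
    simpa [projN] using h1
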